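/- Throughout, graphs are finite, simple and nonempty, and $G[X]$ denotes the subgraph of $G$ induced by $X\subseteq V(G)$. A path decomposition of a graph $G$ is a finite sequence $\mathcal{P}=(X_1,\ldots,X_d)$ of subsets of $V(G)$ such that (1) $\bigcup_{i=1}^d X_i=V(G)$, (2) for each edge $\{u,v\}\in E(G)$ there exists $i$ with $u,v\in X_i$, and (3) $X_i\cap X_k\subseteq X_j$ whenever $1\le i\le j\le k\le d$. Its width is $\max_{1\le i\le d}|X_i|-1$. It is connected if $G[X_1\cup\cdots\cup X_i]$ is connected for each $i=1,\ldots,d$. The pathwidth $\mathrm{pw}(G)$ is the minimum width over all path decompositions of $G$, and the connected pathwidth $\mathrm{cpw}(G)$ is the minimum width over all connected path decompositions of $G$. Theorem. For every connected graph $G$, $\mathrm{cpw}(G)\le 2\cdot\mathrm{pw}(G)+1$. -/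

import Mathlib

/-- A path decomposition `(X_1, …, X_d)` of a simple graph `G`: a finite sequence of bags that
cover all vertices and all edges, and in which every vertex occupies an interval of indices. -/
structure PathDecomposition {V : Type*} (G : SimpleGraph V) where
  /-- the number of bags -/
  d : ℕ
  /-- the bags, indexed by `0, …, d - 1` -/
  bag : Fin d → Finset V
  exists_mem_bag : ∀ v : V, ∃ i, v ∈ bag i
  exists_edge_bag : ∀ u v : V, G.Adj u v → ∃ i, u ∈ bag i ∧ v ∈ bag i
  mem_bag_of_le_of_le : ∀ i j k : Fin d, i ≤ j → j ≤ k →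
    ∀ v : V, v ∈ bag i → v ∈ bag k → v ∈ bag j

namespace PathDecomposition

variable {V : Type*} {G : SimpleGraph V}

/-- The width `max_i |X_i| - 1`. If `V` is nonempty, some bag is nonempty, so that the
subtraction does not truncate (see `width_add_one`). -/
def width (P : PathDecomposition G) : ℕ :=
  (Finset.univ.sup fun i => (P.bag i).card) - 1

/-- `P` is connected if `G[X_1 ∪ ⋯ ∪ X_i]` is connected for each `i`. -/
def IsConnected (P : PathDecomposition G) : Prop :=
  ∀ i : Fin P.d, (G.induce (⋃ j ≤ i, (P.bag j : Set V))).Connected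

theorem width_add_one [Nonempty V] (P : PathDecomposition G) :
    P.width + 1 = Finset.univ.sup fun i => (P.bag i).card := by
  obtain ⟨i, hi⟩ := P.exists_mem_bag (Classical.arbitrary V)
  have h1 : 0 < (P.bag i).card := Finset.card_pos.2 ⟨_, hi⟩
  have h2 : (P.bag i).card ≤ Finset.univ.sup fun i => (P.bag i).card :=
    Finset.le_sup (f := fun i => (P.bag i).card) (Finset.mem_univ i)
  unfold width
  omega

/-- The path decomposition with the single bag `V`. -/
def single [Fintype V] (G : SimpleGraph V) : PathDecomposition G where
  d := 1
  bag _ := Finset.univ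
  exists_mem_bag _ := ⟨0, Finset.mem_univ _⟩
  exists_edge_bag _ _ _ := ⟨0, Finset.mem_univ _, Finset.mem_univ _⟩
  mem_bag_of_le_of_le _ _ _ _ _ _ _ _ := Finset.mem_univ _

theorem single_isConnected [Fintype V] (hG : G.Connected) : (single G).IsConnected := by
  intro i
  have h : (⋃ j ≤ i, ((single G).bag j : Set V)) = Set.univ := by
    refine Set.eq_univ_of_forall fun v => ?_
    simp only [Set.mem_iUnion]
    exact ⟨i, le_rfl, Finset.mem_coe.2 (Finset.mem_univ v)⟩
  rw [h]
  exact (SimpleGraph.induceUnivIso G).connected_iff.2 hG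

end PathDecomposition

/-- The pathwidth: the minimum width over all path decompositions of `G`. -/
noncomputable def pathwidth {V : Type*} (G : SimpleGraph V) : ℕ :=
  sInf {w | ∃ P : PathDecomposition G, P.width = w}

/-- The connected pathwidth: the minimum width over all connected path decompositions of `G`. -/
noncomputable def connectedPathwidth {V : Type*} (G : SimpleGraph V) : ℕ :=
  sInf {w | ∃ P : PathDecomposition G, P.IsConnected ∧ P.width = w}

/-- For finite `G` the minimum in `pathwidth` is attained. -/
theorem pathwidth_isLeast {V : Type*} [Finite V] (G : SimpleGraph V) :
    IsLeast {w | ∃ P : PathDecomposition G, P.width = w} (pathwidth G) := by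
  have := Fintype.ofFinite V
  exact ⟨Nat.sInf_mem ⟨_, PathDecomposition.single G, rfl⟩, fun _ h => Nat.sInf_le h⟩

/-- For finite connected `G` the minimum in `connectedPathwidth` is attained. -/
theorem connectedPathwidth_isLeast {V : Type*} [Finite V] (G : SimpleGraph V)
    (hG : G.Connected) :
    IsLeast {w | ∃ P : PathDecomposition G, P.IsConnected ∧ P.width = w}
      (connectedPathwidth G) := by
  have := Fintype.ofFinite V
  exact ⟨Nat.sInf_mem ⟨_, PathDecomposition.single G,
    PathDecomposition.single_isConnected hG, rfl⟩, fun _ h => Nat.sInf_le h⟩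

/-!
The connected path decomposition is read off from an exploration of `G` that starts at a vertex and
adds one adjacent vertex at a time. Its bags consist of one new vertex and of the explored vertices
that still have unexplored neighbours (`exists_pathDecomposition_of_grow`). So it suffices to
explore `G` with at most `2 * k - 1` such active vertices, where `k` is the largest size of a bag of
the given path decomposition.

*Lean chains.* A path decomposition is a chain of separations of order at most `k`, and one may
assume that its first and last separators are single vertices. Uncrossing with separations of
minimum order (submodularity) makes the chain lean: no separation between two of its members has
smaller order than all members between the two (`exists_isLeanChain`). Mixing two separations
along a union of components then gives a local form of leanness: if the separator at one end of an
interval of the chain is smallest in it, then within each union of components of a region around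
the interval it has at most as many vertices as the separator at the other end
(`IsLeanChain.card_inter_le_right` and `IsLeanChain.card_inter_le_left`).

*Exploring a region.* Consider the region between two separators `L` and `R` of the lean chain
that are no larger than the separators between them, a component `C` of it, and a number `κ` such
that each separator in the interval has at most `κ` vertices in `C`. The claim,
`IsLeanChain.solvable`, is that from every nonempty `J ⊆ C ∩ L` the component can be explored with
at most `2 * κ - #J` active vertices, even if the vertices of `R` and of `L \ J` count as active
once they are found. Split the region at a smallest inner separator `M`. By leanness, a component
`K` of one of the two halves has at most `κ - #((C ∩ M) \ K)` vertices on each separator, so that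
by induction it can be explored within this reduced budget. In `Solvable.glue` these explorations
are carried out one after the other, first for the components that meet `J`, then always for one
that meets the part of `M` found so far. Every explored component keeps at most its vertices on
`L`, on `R` and on `M` active, and it has no more of them on the outer end than on `M`, so each
vertex of `C ∩ M` outside the current component pays for at most two active vertices, and these
are covered by the reduction of the budget. An interval without inner separators has a single
separator as its region, because only one side changes in each step of the chain; there `C` has at
most `κ` vertices and any order will do.

For the whole chain, `C = V`, `κ = k` and `#J = 1`, which gives the bound `2 * k - 1`.
-/

namespace ConnectedPathwidth

variable {V : Type*} (G : SimpleGraph V)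

/-! ### Components of vertex sets -/

/-- `E` is a union of connected components of the subgraph induced by `S`. -/
def IsClosedIn (S E : Finset V) : Prop :=
  E ⊆ S ∧ ∀ u ∈ E, ∀ w ∈ S, G.Adj u w → w ∈ E

/-- Connectedness of the subgraph induced by `K`, in the form used for growing sets: every
nonempty proper subset of `K` has an edge to the rest of `K`. The empty set is allowed. -/
def IsCutConnected (K : Finset V) : Prop :=
  ∀ J ⊆ K, J.Nonempty → J ≠ K → ∃ u ∈ J, ∃ w ∈ K, w ∉ J ∧ G.Adj u w

/-- `K` is a connected component of the subgraph induced by `S`, or empty. -/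
def IsComponentOf (S K : Finset V) : Prop :=
  IsClosedIn G S K ∧ IsCutConnected G K

variable {G}

theorem isClosedIn_self (S : Finset V) : IsClosedIn G S S :=
  ⟨subset_rfl, fun _ _ _ hw _ => hw⟩

theorem isClosedIn_empty (S : Finset V) : IsClosedIn G S ∅ :=
  ⟨Finset.empty_subset S, fun _ hu => absurd hu (Finset.notMem_empty _)⟩

theorem IsClosedIn.trans {S T E : Finset V} (hT : IsClosedIn G S T) (hE : IsClosedIn G T E) :
    IsClosedIn G S E :=
  ⟨hE.1.trans hT.1, fun u hu w hw h => hE.2 u hu w (hT.2 u (hE.1 hu) w hw h) h⟩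

theorem IsClosedIn.eq_univ [Fintype V] (hG : G.Connected) {E : Finset V} {v : V} (hv : v ∈ E)
    (hE : IsClosedIn G Finset.univ E) : E = Finset.univ := by
  refine Finset.eq_univ_of_forall fun w => ?_
  have h := (SimpleGraph.reachable_iff_reflTransGen v w).1 (hG.preconnected v w)
  induction h with
  | refl => exact hv
  | tail _ h ih => exact hE.2 _ ih _ (Finset.mem_univ _) h

variable [DecidableEq V]

theorem IsClosedIn.sdiff {S E F : Finset V} (hE : IsClosedIn G S E) (hF : IsClosedIn G S F) :
    IsClosedIn G S (E \ F) := by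
  refine ⟨fun x hx => hE.1 (Finset.mem_sdiff.1 hx).1, fun u hu w hw h => ?_⟩
  rw [Finset.mem_sdiff] at hu ⊢
  exact ⟨hE.2 u hu.1 w hw h, fun hwF => hu.2 (hF.2 w hwF u (hE.1 hu.1) h.symm)⟩

theorem IsClosedIn.union {S E F : Finset V} (hE : IsClosedIn G S E) (hF : IsClosedIn G S F) :
    IsClosedIn G S (E ∪ F) := by
  refine ⟨Finset.union_subset hE.1 hF.1, fun u hu w hw h => ?_⟩
  rw [Finset.mem_union] at hu ⊢
  exact hu.imp (fun hu => hE.2 u hu w hw h) (fun hu => hF.2 u hu w hw h)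

theorem IsClosedIn.inter_of_subset {S T E : Finset V} (hE : IsClosedIn G S E) (hT : T ⊆ S) :
    IsClosedIn G T (E ∩ T) := by
  refine ⟨Finset.inter_subset_right, fun u hu w hw h => ?_⟩
  rw [Finset.mem_inter] at hu ⊢
  exact ⟨hE.2 u hu.1 w (hT hw) h, hw⟩

theorem exists_isComponentOf {S : Finset V} {x : V} (hx : x ∈ S) :
    ∃ K, x ∈ K ∧ IsComponentOf G S K := by
  classical
  let r : V → V → Prop := fun a b => G.Adj a b ∧ a ∈ S ∧ b ∈ S
  have hr : ∀ a b, Relation.ReflTransGen r a b → Relation.ReflTransGen r b a := by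
    intro a b h
    induction h with
    | refl => exact .refl
    | tail _ h ih => exact ih.head ⟨h.1.symm, h.2.2, h.2.1⟩
  refine ⟨S.filter (Relation.ReflTransGen r x), by simp [hx, Relation.ReflTransGen.refl],
    ⟨Finset.filter_subset _ _, ?_⟩, ?_⟩
  · intro u hu w hw h
    rw [Finset.mem_filter] at hu ⊢
    exact ⟨hw, hu.2.tail ⟨h, hu.1, hw⟩⟩
  · rintro J hJ ⟨a, ha⟩ hne
    by_contra hcon
    push Not at hcon
    apply hne
    refine hJ.antisymm fun b hb => ?_
    have ha' := Finset.mem_filter.1 (hJ ha)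
    have hb' := Finset.mem_filter.1 hb
    have hab : Relation.ReflTransGen r a b := (hr _ _ ha'.2).trans hb'.2
    clear hb hb'
    have : b ∈ J := by
      induction hab with
      | refl => exact ha
      | tail _ hst ih =>
        by_contra hn
        refine hcon _ ih _ ?_ hn hst.1
        exact Finset.mem_filter.2 ⟨hst.2.2, (Finset.mem_filter.1 (hJ ih)).2.tail hst⟩
    exact this

/-- A component is disjoint from every union of components that does not contain it. -/
theorem IsComponentOf.disjoint {S K E : Finset V} (hK : IsComponentOf G S K)
    (hE : IsClosedIn G S E) {x : V} (hxK : x ∈ K) (hxE : x ∉ E) : Disjoint K E := by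
  rw [Finset.disjoint_iff_inter_eq_empty]
  by_contra hne
  obtain ⟨u, hu, w, hw, hwn, h⟩ := hK.2 (K ∩ E) Finset.inter_subset_left
    (Finset.nonempty_iff_ne_empty.2 hne)
    (fun h => hxE (Finset.inter_eq_left.1 h hxK))
  exact hwn (Finset.mem_inter.2 ⟨hw, hE.2 u (Finset.mem_inter.1 hu).2 w (hK.1.1 hw) h⟩)

/-! ### Growing connected sets -/

variable (G)

open Classical in
/-- The vertices of `U` that have to be kept while `K` is explored and `U` is the part found so
far: those in the set `Z` of pinned vertices and those with a neighbour in `K \ U`. -/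
noncomputable def active (K Z U : Finset V) : Finset V :=
  U.filter fun x => x ∈ Z ∨ ∃ y ∈ K, y ∉ U ∧ G.Adj x y

/-- `Grow G K Z b U W`: the set `U` can be enlarged to `W` inside `K` by adding one vertex at a
time, each adjacent to the current set, so that each new set has at most `b` active vertices. -/
def Grow (K Z : Finset V) (b : ℕ) : Finset V → Finset V → Prop :=
  Relation.ReflTransGen fun U U' =>
    ∃ x ∈ K, x ∉ U ∧ (∃ y ∈ U, G.Adj y x) ∧ U' = insert x U ∧ (active G K Z U').card ≤ b

/-- `K`, with the two end sets `P` and `Q`, can be explored from every nonempty entry set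
`J ⊆ K ∩ P` with at most `2 * κ - #J` active vertices, where both ends stay pinned except for
the vertices of `J`. -/
def Solvable (P Q K : Finset V) (κ : ℕ) : Prop :=
  ∀ J ⊆ K, J ⊆ P → J.Nonempty → Grow G K (Q ∪ (P \ J)) (2 * κ - J.card) J K

variable {G}

theorem mem_active {K Z U : Finset V} {x : V} :
    x ∈ active G K Z U ↔ x ∈ U ∧ (x ∈ Z ∨ ∃ y ∈ K, y ∉ U ∧ G.Adj x y) := by
  classical
  simp [active]

/-- Growing `K` from `J` can be carried out on top of a set `A` that meets `K` exactly in `J`. -/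
theorem Grow.lift {C Z K Y A J : Finset V} {b c : ℕ} (hK : K ⊆ C) (hA : A ∩ K = J)
    (hb : ∀ U, J ⊆ U → U ⊆ K → (active G K Y U).card ≤ c → (active G C Z (A ∪ U)).card ≤ b)
    {W : Finset V} (h : Grow G K Y c J W) : Grow G C Z b A (A ∪ W) ∧ J ⊆ W ∧ W ⊆ K := by
  induction h with
  | refl =>
    have hJ : J ⊆ A ∧ J ⊆ K := by
      rw [← hA]; exact ⟨Finset.inter_subset_left, Finset.inter_subset_right⟩
    rw [Finset.union_eq_left.2 hJ.1]
    exact ⟨.refl, subset_rfl, hJ.2⟩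
  | @tail U W _ hs ih =>
    obtain ⟨x, hxK, hxU, ⟨y, hyU, hyx⟩, rfl, hc⟩ := hs
    have hJ : J ⊆ insert x U := ih.2.1.trans (Finset.subset_insert _ _)
    have hUK : insert x U ⊆ K := Finset.insert_subset hxK ih.2.2
    refine ⟨ih.1.tail ⟨x, hK hxK, ?_, ⟨y, Finset.mem_union_right _ hyU, hyx⟩, ?_, hb _ hJ hUK hc⟩,
      hJ, hUK⟩
    · rw [Finset.mem_union, not_or]
      exact ⟨fun hxA => hxU (ih.2.1 (hA ▸ Finset.mem_inter.2 ⟨hxA, hxK⟩)), hxU⟩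
    · rw [Finset.union_insert]

/-- A small connected set can be explored in any connected order. -/
theorem solvable_of_card_le {P Q K : Finset V} {κ : ℕ} (hK : IsCutConnected G K)
    (hκ : K.card ≤ κ) : Solvable G P Q K κ := by
  intro J hJK _ hJ
  have hJκ := (Finset.card_le_card hJK).trans hκ
  have key : ∀ n, ∀ U ⊆ K, U.Nonempty → (K \ U).card = n →
      Grow G K (Q ∪ (P \ J)) (2 * κ - J.card) U K := by
    intro n
    induction n with
    | zero =>
      intro U hU _ h
      rw [Finset.card_eq_zero, Finset.sdiff_eq_empty_iff_subset] at h
      rw [hU.antisymm h]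
      exact .refl
    | succ n ih =>
      intro U hU hne h
      obtain ⟨u, hu, w, hw, hwU, huw⟩ := hK U hU hne (by rintro rfl; simp at h)
      have hU' : insert w U ⊆ K := Finset.insert_subset hw hU
      refine .head ⟨w, hw, hwU, ⟨u, hu, huw⟩, rfl, ?_⟩ (ih _ hU' (Finset.insert_nonempty _ _) ?_)
      · have h1 : active G K (Q ∪ (P \ J)) (insert w U) ⊆ K :=
          fun x hx => hU' (mem_active.1 hx).1
        have := Finset.card_le_card h1
        omega
      · rw [Finset.sdiff_insert, Finset.card_erase_of_mem (Finset.mem_sdiff.2 ⟨hw, hwU⟩), h]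
        rfl
  exact key _ J hJK hJ rfl

/-! ### Gluing two regions along a common end -/

/-- The active vertices while a component `K` of `S₁` is explored, on top of explored unions of
components `E₁` of `S₁` and `E₂` of `S₂`, where `K` is entered from `E₂`. -/
theorem active_union_subset {C S₁ S₂ M L R Q E₁ E₂ K U : Finset V}
    (hM : ∀ x ∈ S₁, x ∈ S₂ → x ∈ M)
    (hS₁ : S₁ ⊆ C) (hS₂ : S₂ ⊆ C)
    (hedge : ∀ u ∈ C, ∀ w ∈ C, G.Adj u w → u ∈ S₁ ∧ w ∈ S₁ ∨ u ∈ S₂ ∧ w ∈ S₂)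
    (hL : ∀ x ∈ C, x ∈ L → x ∈ S₁) (hR : ∀ x ∈ C, x ∈ R → x ∈ S₂)
    (hE₁ : IsClosedIn G S₁ E₁) (hE₂ : IsClosedIn G S₂ E₂) (hK : IsClosedIn G S₁ K)
    (hJU : E₂ ∩ K ⊆ U) (hUK : U ⊆ K) (hKE : Disjoint K E₁) (hQ : L ⊆ Q) :
    active G C (L ∪ R) (E₁ ∪ E₂ ∪ U) ⊆
      active G K (Q ∪ (M \ (E₂ ∩ K))) U ∪ (E₁ ∩ L) ∪ (E₂ ∩ R) ∪ ((E₁ ∩ M) \ E₂) ∪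
        (((E₂ ∩ M) \ E₁) \ K) := by
  intro x hx
  rw [mem_active] at hx
  obtain ⟨hxA, hx⟩ := hx
  have e1 := hE₁.1
  have e2 := hE₂.1
  have k1 := hK.1
  have hxC : x ∈ C := by
    simp only [Finset.mem_union] at hxA
    rcases hxA with (h | h) | h
    exacts [hS₁ (e1 h), hS₂ (e2 h), hS₁ (k1 (hUK h))]
  simp only [Finset.mem_union, Finset.mem_sdiff, Finset.mem_inter, mem_active]
  simp only [Finset.mem_union, not_or] at hxA hx
  have hKE' : x ∈ K → x ∉ E₁ := fun h h' => Finset.disjoint_left.1 hKE h h'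
  have hKU : x ∈ K → x ∈ E₂ → x ∈ U := fun h h' => hJU (Finset.mem_inter.2 ⟨h', h⟩)
  have hUK' : x ∈ U → x ∈ K := fun h => hUK h
  have f1 : x ∈ E₁ → x ∈ S₁ := fun h => e1 h
  have f2 : x ∈ E₂ → x ∈ S₂ := fun h => e2 h
  have f3 : x ∈ K → x ∈ S₁ := fun h => k1 h
  have f4 := hM x
  have f5 := hL x hxC
  have f6 := hR x hxC
  have f7 : x ∈ L → x ∈ Q := fun h => hQ h
  rcases hx with (hx | hx) | ⟨y, hyC, ⟨⟨hy1, hy2⟩, hyU⟩, hxy⟩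
  · grind
  · grind
  · rcases hedge x hxC y hyC hxy with ⟨hx1, hy⟩ | ⟨hx1, hy⟩
    · have g1 : x ∉ E₁ := fun h => hy1 (hE₁.2 x h y hy hxy)
      by_cases hxK : x ∈ K
      · have g2 : y ∈ K := hK.2 x hxK y hy hxy
        have : x ∈ U := by grind
        exact Or.inl (Or.inl (Or.inl (Or.inl ⟨this, Or.inr ⟨y, g2, hyU, hxy⟩⟩)))
      · grind
    · have g1 : x ∉ E₂ := fun h => hy2 (hE₂.2 x h y hy hxy)
      grind

/-- The active vertices while a component `K` of `S₁` is explored from the given entry set `J`,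
on top of an explored union `E` of components of `S₁`. -/
theorem active_union_entry_subset {C S₁ S₂ M L R E J K U : Finset V}
    (hM : ∀ x ∈ S₁, x ∈ S₂ → x ∈ M) (hS₁ : S₁ ⊆ C) (hJ : J ⊆ S₁)
    (hedge : ∀ u ∈ C, ∀ w ∈ C, G.Adj u w → u ∈ S₁ ∧ w ∈ S₁ ∨ u ∈ S₂ ∧ w ∈ S₂)
    (hR : ∀ x ∈ C, x ∈ R → x ∈ S₂)
    (hE : IsClosedIn G S₁ E) (hK : IsClosedIn G S₁ K)
    (hJU : J ∩ K ⊆ U) (hUK : U ⊆ K) (hKE : Disjoint K E) :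
    active G C (R ∪ (L \ J)) (J ∪ E ∪ U) ⊆
      active G K (M ∪ (L \ (J ∩ K))) U ∪ (E ∩ M) ∪ ((E ∩ L) \ J) ∪ ((J \ E) \ K) := by
  intro x hx
  rw [mem_active] at hx
  obtain ⟨hxA, hx⟩ := hx
  have e1 := hE.1
  have k1 := hK.1
  have hxS : x ∈ S₁ := by
    simp only [Finset.mem_union] at hxA
    rcases hxA with (h | h) | h
    exacts [hJ h, e1 h, k1 (hUK h)]
  have hxC := hS₁ hxS
  simp only [Finset.mem_union, Finset.mem_sdiff, Finset.mem_inter, mem_active]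
  simp only [Finset.mem_union, Finset.mem_sdiff, not_or] at hxA hx
  have hKE' : x ∈ K → x ∉ E := fun h h' => Finset.disjoint_left.1 hKE h h'
  have hKU : x ∈ K → x ∈ J → x ∈ U := fun h h' => hJU (Finset.mem_inter.2 ⟨h', h⟩)
  have hUK' : x ∈ U → x ∈ K := fun h => hUK h
  have f4 := hM x
  have f6 := hR x hxC
  rcases hx with (hx | hx) | ⟨y, hyC, ⟨⟨hy1, hy2⟩, hyU⟩, hxy⟩
  · grind
  · grind
  · rcases hedge x hxC y hyC hxy with ⟨hx1, hy⟩ | ⟨hx1, hy⟩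
    · have g1 : x ∉ E := fun h => hy2 (hE.2 x h y hy hxy)
      by_cases hxK : x ∈ K
      · have g2 : y ∈ K := hK.2 x hxK y hy hxy
        have : x ∈ U := by grind
        exact Or.inl (Or.inl (Or.inl ⟨this, Or.inr ⟨y, g2, hyU, hxy⟩⟩))
      · grind
    · grind

/-- With unions of components `E₁` of `S₁` and `E₂` of `S₂` explored, a further component `K` of
`S₁` can be explored from `E₂ ∩ K`. The number `t` bounds from below the surplus of the common
end `M` over the outer ends within `E₁` and `E₂`. -/
theorem grow_component {C S₁ S₂ M L R Q E₁ E₂ K : Finset V} {κ t : ℕ}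
    (hM : ∀ x ∈ S₁, x ∈ S₂ → x ∈ M)
    (hS₁ : S₁ ⊆ C) (hS₂ : S₂ ⊆ C)
    (hedge : ∀ u ∈ C, ∀ w ∈ C, G.Adj u w → u ∈ S₁ ∧ w ∈ S₁ ∨ u ∈ S₂ ∧ w ∈ S₂)
    (hL : ∀ x ∈ C, x ∈ L → x ∈ S₁) (hR : ∀ x ∈ C, x ∈ R → x ∈ S₂)
    (hE₁ : IsClosedIn G S₁ E₁) (hE₂ : IsClosedIn G S₂ E₂) (hK : IsClosedIn G S₁ K)
    (hKE : Disjoint K E₁) (hQ : L ⊆ Q) (hκ : (C ∩ M).card ≤ κ)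
    (hnum : (E₁ ∩ L).card + (E₂ ∩ R).card + t ≤ (E₁ ∩ M).card + (E₂ ∩ M).card)
    (hne : (E₂ ∩ K).Nonempty)
    (hsolv : Solvable G M Q K (κ - ((C ∩ M) \ K).card)) :
    Grow G C (L ∪ R) (2 * κ - t) (E₁ ∪ E₂) (E₁ ∪ E₂ ∪ K) := by
  have hJM : E₂ ∩ K ⊆ M := fun x hx =>
    hM x (hK.1 (Finset.mem_inter.1 hx).2) (hE₂.1 (Finset.mem_inter.1 hx).1)
  have hA : (E₁ ∪ E₂) ∩ K = E₂ ∩ K := by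
    rw [Finset.union_inter_distrib_right, Finset.inter_comm E₁,
      Finset.disjoint_iff_inter_eq_empty.1 hKE, Finset.empty_union]
  refine (Grow.lift (hK.1.trans hS₁) hA (fun U hJU hUK hU => ?_)
    (hsolv _ Finset.inter_subset_right hJM hne)).1
  have h1 := Finset.card_le_card (active_union_subset hM hS₁ hS₂ hedge hL hR hE₁ hE₂ hK hJU hUK
    hKE hQ)
  have h2 := (h1.trans (Finset.card_union_le _ _))
  have h3 := Finset.card_union_le (active G K (Q ∪ (M \ (E₂ ∩ K))) U ∪ (E₁ ∩ L) ∪ (E₂ ∩ R))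
    ((E₁ ∩ M) \ E₂)
  have h4 := Finset.card_union_le (active G K (Q ∪ (M \ (E₂ ∩ K))) U ∪ (E₁ ∩ L)) (E₂ ∩ R)
  have h5 := Finset.card_union_le (active G K (Q ∪ (M \ (E₂ ∩ K))) U) (E₁ ∩ L)
  have hC1 : E₁ ⊆ C := hE₁.1.trans hS₁
  have hC2 : E₂ ⊆ C := hE₂.1.trans hS₂
  have hd : ∀ x ∈ K, x ∉ E₁ := fun x h h' => Finset.disjoint_left.1 hKE h h'
  -- outside `K`, each common end vertex is charged at most twice
  have n1 : (E₁ ∩ M).card + (((E₂ ∩ M) \ E₁) \ K).card ≤ ((C ∩ M) \ K).card := by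
    rw [← Finset.card_union_of_disjoint]
    · apply Finset.card_le_card
      intro x
      have := @hC1 x
      have := @hC2 x
      have := hd x
      simp only [Finset.mem_union, Finset.mem_sdiff, Finset.mem_inter]
      tauto
    · rw [Finset.disjoint_left]
      intro x
      simp only [Finset.mem_sdiff, Finset.mem_inter]
      tauto
  have n2 : ((E₂ ∩ M) \ K).card + ((E₁ ∩ M) \ E₂).card ≤ ((C ∩ M) \ K).card := by
    rw [← Finset.card_union_of_disjoint]
    · apply Finset.card_le_card
      intro x
      have := @hC1 x
      have := @hC2 x
      have := hd x
      simp only [Finset.mem_union, Finset.mem_sdiff, Finset.mem_inter]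
      tauto
    · rw [Finset.disjoint_left]
      intro x
      simp only [Finset.mem_sdiff, Finset.mem_inter]
      tauto
  have n3 : (E₂ ∩ M).card = ((E₂ ∩ M) \ K).card + (E₂ ∩ K).card := by
    rw [← Finset.card_sdiff_add_card_inter (E₂ ∩ M) K]
    congr 2
    ext x
    have := @hJM x
    simp only [Finset.mem_inter] at *
    tauto
  have n4 : (E₂ ∩ K).card + ((C ∩ M) \ K).card ≤ κ := by
    refine le_trans ?_ hκ
    rw [← Finset.card_union_of_disjoint]
    · apply Finset.card_le_card
      intro x
      have := @hC2 x
      have := @hJM x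
      simp only [Finset.mem_union, Finset.mem_sdiff, Finset.mem_inter] at *
      tauto
    · rw [Finset.disjoint_left]
      intro x
      simp only [Finset.mem_sdiff, Finset.mem_inter]
      tauto
  omega

/-- With the entry set `J` and a union `E` of components of `S₁` explored, a further component `K`
of `S₁` that meets `J` can be explored from `J ∩ K`. -/
theorem grow_entry_component {C S₁ S₂ M L R E J K : Finset V} {κ : ℕ}
    (hM : ∀ x ∈ S₁, x ∈ S₂ → x ∈ M) (hS₁ : S₁ ⊆ C) (hJ : J ⊆ S₁) (hJL : J ⊆ L)
    (hedge : ∀ u ∈ C, ∀ w ∈ C, G.Adj u w → u ∈ S₁ ∧ w ∈ S₁ ∨ u ∈ S₂ ∧ w ∈ S₂)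
    (hR : ∀ x ∈ C, x ∈ R → x ∈ S₂)
    (hE : IsClosedIn G S₁ E) (hK : IsClosedIn G S₁ K) (hKE : Disjoint K E)
    (hκ : (C ∩ M).card ≤ κ)
    (hlink : ∀ F, IsClosedIn G S₁ F → (F ∩ L).card ≤ (F ∩ M).card)
    (hne : (J ∩ K).Nonempty)
    (hsolv : Solvable G L M K (κ - ((C ∩ M) \ K).card)) :
    Grow G C (R ∪ (L \ J)) (2 * κ - J.card) (J ∪ E) (J ∪ E ∪ K) := by
  have hA : (J ∪ E) ∩ K = J ∩ K := by
    rw [Finset.union_inter_distrib_right, Finset.inter_comm E,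
      Finset.disjoint_iff_inter_eq_empty.1 hKE, Finset.union_empty]
  refine (Grow.lift (hK.1.trans hS₁) hA (fun U hJU hUK hU => ?_)
    (hsolv _ Finset.inter_subset_right (Finset.inter_subset_left.trans hJL) hne)).1
  have h1 := Finset.card_le_card (active_union_entry_subset (L := L) hM hS₁ hJ hedge hR hE hK hJU
    hUK hKE)
  have h2 := (h1.trans (Finset.card_union_le _ _))
  have h3 := Finset.card_union_le (active G K (M ∪ (L \ (J ∩ K))) U ∪ (E ∩ M)) ((E ∩ L) \ J)
  have h4 := Finset.card_union_le (active G K (M ∪ (L \ (J ∩ K))) U) (E ∩ M)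
  have hd : ∀ x ∈ K, x ∉ E := fun x h h' => Finset.disjoint_left.1 hKE h h'
  have n0 := hlink _ (((isClosedIn_self S₁).sdiff hE).sdiff hK)
  have n1 : ((J \ E) \ K).card ≤ (((S₁ \ E) \ K) ∩ L).card := by
    apply Finset.card_le_card
    intro x
    have := @hJ x
    have := @hJL x
    simp only [Finset.mem_sdiff, Finset.mem_inter]
    tauto
  have n2 : (E ∩ M).card + (((S₁ \ E) \ K) ∩ M).card ≤ ((C ∩ M) \ K).card := by
    rw [← Finset.card_union_of_disjoint]
    · apply Finset.card_le_card
      intro x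
      have := @hS₁ x
      have := @hE.1 x
      have := hd x
      simp only [Finset.mem_union, Finset.mem_sdiff, Finset.mem_inter]
      tauto
    · rw [Finset.disjoint_left]
      intro x
      simp only [Finset.mem_sdiff, Finset.mem_inter]
      tauto
  have n3 := hlink _ hE
  have n4 : ((E ∩ L) \ J).card + (E ∩ J).card = (E ∩ L).card := by
    rw [← Finset.card_sdiff_add_card_inter (E ∩ L) J]
    congr 2
    ext x
    have := @hJL x
    simp only [Finset.mem_inter] at *
    tauto
  have n5 : J.card = ((J \ E) \ K).card + (J ∩ K).card + (E ∩ J).card := by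
    rw [← Finset.card_sdiff_add_card_inter J E, ← Finset.card_sdiff_add_card_inter (J \ E) K,
      Finset.inter_comm J E]
    congr 3
    ext x
    have := hd x
    simp only [Finset.mem_inter, Finset.mem_sdiff]
    tauto
  have n6 : (J ∩ K).card ≤ (K ∩ L).card := by
    apply Finset.card_le_card
    intro x
    have := @hJL x
    simp only [Finset.mem_inter]
    tauto
  have n7 := hlink _ hK
  have n8 : (K ∩ M).card + ((C ∩ M) \ K).card ≤ κ := by
    refine le_trans ?_ hκ
    rw [← Finset.card_union_of_disjoint]
    · apply Finset.card_le_card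
      intro x
      have := @hS₁ x
      have := @hK.1 x
      simp only [Finset.mem_union, Finset.mem_sdiff, Finset.mem_inter] at *
      tauto
    · rw [Finset.disjoint_left]
      intro x
      simp only [Finset.mem_sdiff, Finset.mem_inter]
      tauto
  omega

/-- If the components of two regions `S₁`, `S₂` with common end `M` can be explored, each with a
budget reduced by the part of `M` that it misses, then so can the connected union `C` of the
regions. The hypotheses `hlinkL` and `hlinkR` say that `M` is at least as large as the outer ends
within any union of components. -/
theorem Solvable.glue {C S₁ S₂ L M R : Finset V} {κ : ℕ} (hC : IsCutConnected G C)
    (hS₁ : S₁ ⊆ C) (hS₂ : S₂ ⊆ C) (hM : ∀ x ∈ S₁, x ∈ S₂ → x ∈ M)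
    (hedge : ∀ u ∈ C, ∀ w ∈ C, G.Adj u w → u ∈ S₁ ∧ w ∈ S₁ ∨ u ∈ S₂ ∧ w ∈ S₂)
    (hL : ∀ x ∈ C, x ∈ L → x ∈ S₁) (hR : ∀ x ∈ C, x ∈ R → x ∈ S₂)
    (hlinkL : ∀ F, IsClosedIn G S₁ F → (F ∩ L).card ≤ (F ∩ M).card)
    (hlinkR : ∀ F, IsClosedIn G S₂ F → (F ∩ R).card ≤ (F ∩ M).card)
    (hκ : (C ∩ M).card ≤ κ)
    (h₁ : ∀ K, IsComponentOf G S₁ K → Solvable G L M K (κ - ((C ∩ M) \ K).card))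
    (h₁' : ∀ K, IsComponentOf G S₁ K → Solvable G M L K (κ - ((C ∩ M) \ K).card))
    (h₂ : ∀ K, IsComponentOf G S₂ K → Solvable G M R K (κ - ((C ∩ M) \ K).card)) :
    Solvable G L R C κ := by
  intro J hJC hJL hJ
  have hJS : J ⊆ S₁ := fun x hx => hL x (hJC hx) (hJL hx)
  -- first the components of `S₁` that meet `J`
  have growEntry : ∀ n, ∀ E, IsClosedIn G S₁ E → (J \ E).card ≤ n →
      ∃ E', IsClosedIn G S₁ E' ∧ J ⊆ E' ∧
        Grow G C (R ∪ (L \ J)) (2 * κ - J.card) (J ∪ E) E' := by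
    intro n
    induction n with
    | zero =>
      intro E hE h
      rw [Nat.le_zero, Finset.card_eq_zero, Finset.sdiff_eq_empty_iff_subset] at h
      exact ⟨E, hE, h, by rw [Finset.union_eq_right.2 h]; exact .refl⟩
    | succ n ih =>
      intro E hE h
      by_cases hJE : J ⊆ E
      · exact ⟨E, hE, hJE, by rw [Finset.union_eq_right.2 hJE]; exact .refl⟩
      obtain ⟨x, hxJ, hxE⟩ := Finset.not_subset.1 hJE
      obtain ⟨K, hxK, hK⟩ := exists_isComponentOf (G := G) (hJS hxJ)
      have hKE := hK.disjoint hE hxK hxE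
      obtain ⟨E', h1, h2, h3⟩ := ih (E ∪ K) (hE.union hK.1) (by
        have : J \ (E ∪ K) ⊂ J \ E := by
          rw [Finset.ssubset_iff_of_subset
            (Finset.sdiff_subset_sdiff subset_rfl Finset.subset_union_left)]
          exact ⟨x, by simp [hxJ, hxE], by simp [hxK]⟩
        have := Finset.card_lt_card this
        omega)
      refine ⟨E', h1, h2, .trans ?_ h3⟩
      rw [← Finset.union_assoc]
      exact grow_entry_component hM hS₁ hJS hJL hedge hR hE hK.1 hKE hκ hlinkL
        ⟨x, Finset.mem_inter.2 ⟨hxJ, hxK⟩⟩ (h₁ K hK)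
  -- then all other components, entered from components on the other side
  have growRest : ∀ n, ∀ E₁ E₂, IsClosedIn G S₁ E₁ → IsClosedIn G S₂ E₂ → J ⊆ E₁ →
      (C \ (E₁ ∪ E₂)).card ≤ n →
      Grow G C (R ∪ (L \ J)) (2 * κ - J.card) (E₁ ∪ E₂) C := by
    intro n
    induction n with
    | zero =>
      intro E₁ E₂ hE₁ hE₂ hJE h
      rw [Nat.le_zero, Finset.card_eq_zero, Finset.sdiff_eq_empty_iff_subset] at h
      rw [(Finset.union_subset (hE₁.1.trans hS₁) (hE₂.1.trans hS₂)).antisymm h]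
      exact .refl
    | succ n ih =>
      intro E₁ E₂ hE₁ hE₂ hJE h
      have hEC := Finset.union_subset (hE₁.1.trans hS₁) (hE₂.1.trans hS₂)
      by_cases hEq : E₁ ∪ E₂ = C
      · rw [hEq]; exact .refl
      obtain ⟨u, hu, w, hw, hwE, huw⟩ := hC _ hEC
        (hJ.mono (hJE.trans Finset.subset_union_left)) hEq
      rw [Finset.mem_union, not_or] at hwE
      have hnum : (E₁ ∩ (L \ J)).card + (E₂ ∩ R).card + J.card ≤
          (E₁ ∩ M).card + (E₂ ∩ M).card := by
        have n1 := hlinkL E₁ hE₁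
        have n2 := hlinkR E₂ hE₂
        have n3 : (E₁ ∩ (L \ J)).card + J.card = (E₁ ∩ L).card := by
          rw [← Finset.card_sdiff_add_card_inter (E₁ ∩ L) J]
          congr 2
          · ext x
            simp only [Finset.mem_inter, Finset.mem_sdiff]
            tauto
          · ext x
            have := @hJL x
            have := @hJE x
            simp only [Finset.mem_inter]
            tauto
        omega
      have hL' : ∀ x ∈ C, x ∈ L \ J → x ∈ S₁ := fun x hx h => hL x hx (Finset.mem_sdiff.1 h).1
      have hlt : ∀ K, w ∈ K → (C \ (E₁ ∪ E₂ ∪ K)).card ≤ n := by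
        intro K hwK
        have : C \ (E₁ ∪ E₂ ∪ K) ⊂ C \ (E₁ ∪ E₂) := by
          rw [Finset.ssubset_iff_of_subset
            (Finset.sdiff_subset_sdiff subset_rfl Finset.subset_union_left)]
          exact ⟨w, by simp [hw, hwE], by simp [hwK]⟩
        have := Finset.card_lt_card this
        omega
      have huC := hEC hu
      rw [Finset.mem_union] at hu
      rcases hedge u huC w hw huw with ⟨hu1, hw1⟩ | ⟨hu1, hw1⟩
      · obtain ⟨K, hwK, hK⟩ := exists_isComponentOf (G := G) hw1
        have hKE := hK.disjoint hE₁ hwK hwE.1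
        have huE : u ∈ E₂ := hu.resolve_left fun h => hwE.1 (hE₁.2 u h w hw1 huw)
        have huK : u ∈ K := hK.1.2 w hwK u hu1 huw.symm
        have step := grow_component (Q := L) (t := J.card) hM hS₁ hS₂ hedge hL' hR hE₁ hE₂ hK.1
          hKE Finset.sdiff_subset hκ hnum ⟨u, Finset.mem_inter.2 ⟨huE, huK⟩⟩ (h₁' K hK)
        rw [Finset.union_comm (L \ J)] at step
        refine step.trans ?_
        have hEK : E₁ ∪ E₂ ∪ K = (E₁ ∪ K) ∪ E₂ := Finset.union_right_comm _ _ _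
        have := hlt K hwK
        rw [hEK] at this ⊢
        exact ih _ _ (hE₁.union hK.1) hE₂ (hJE.trans Finset.subset_union_left) this
      · obtain ⟨K, hwK, hK⟩ := exists_isComponentOf (G := G) hw1
        have hKE := hK.disjoint hE₂ hwK hwE.2
        have huE : u ∈ E₁ := hu.resolve_right fun h => hwE.2 (hE₂.2 u h w hw1 huw)
        have huK : u ∈ K := hK.1.2 w hwK u hu1 huw.symm
        have step := grow_component (Q := R) (t := J.card) (fun x h h' => hM x h' h) hS₂ hS₁
          (fun u hu w hw h => (hedge u hu w hw h).symm) hR hL' hE₂ hE₁ hK.1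
          hKE subset_rfl hκ (by omega) ⟨u, Finset.mem_inter.2 ⟨huE, huK⟩⟩ (h₂ K hK)
        rw [Finset.union_comm E₂] at step
        refine step.trans ?_
        have hEK : E₁ ∪ E₂ ∪ K = E₁ ∪ (E₂ ∪ K) := Finset.union_assoc _ _ _
        have := hlt K hwK
        rw [hEK] at this ⊢
        exact ih _ _ hE₁ (hE₂.union hK.1) hJE this
  obtain ⟨E, hE, hJE, hg⟩ := growEntry _ ∅ (isClosedIn_empty _) le_rfl
  rw [Finset.union_empty] at hg
  have := growRest _ E ∅ hE (isClosedIn_empty _) hJE le_rfl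
  rw [Finset.union_empty] at this
  exact hg.trans this

/-! ### Separations and lean chains -/

variable (G)

/-- A separation, encoded as a pair `(D, A)` of vertex sets: `A` is the left side, and `D` is the
part of `A` outside the right side, so that all neighbours of `D` lie in `A`. With this encoding
the order on separations is the product order. -/
def IsSeparation (N : Finset V × Finset V) : Prop :=
  N.1 ⊆ N.2 ∧ ∀ u ∈ N.1, ∀ w, G.Adj u w → w ∈ N.2

/-- The separator `A \ D` of the separation `(D, A)`. -/
def separator (N : Finset V × Finset V) : Finset V :=
  N.2 \ N.1

/-- The vertices that lie to the right of `L` and to the left of `R`, separators included. -/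
def region (L R : Finset V × Finset V) : Finset V :=
  R.2 \ L.1

variable {G}

theorem IsSeparation.inf {N M : Finset V × Finset V} (hN : IsSeparation G N)
    (hM : IsSeparation G M) : IsSeparation G (N ⊓ M) := by
  refine ⟨Finset.inter_subset_inter hN.1 hM.1, fun u hu w h => ?_⟩
  have hu := Finset.mem_inter.1 hu
  exact Finset.mem_inter.2 ⟨hN.2 u hu.1 w h, hM.2 u hu.2 w h⟩

theorem IsSeparation.sup {N M : Finset V × Finset V} (hN : IsSeparation G N)
    (hM : IsSeparation G M) : IsSeparation G (N ⊔ M) := by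
  refine ⟨Finset.union_subset_union hN.1 hM.1, fun u hu w h => ?_⟩
  exact Finset.mem_union.2 ((Finset.mem_union.1 hu).imp (fun hu => hN.2 u hu w h)
    (fun hu => hM.2 u hu w h))

theorem card_separator_inf_add_sup {N M : Finset V × Finset V} (hN : IsSeparation G N)
    (hM : IsSeparation G M) :
    (separator (N ⊓ M)).card + (separator (N ⊔ M)).card =
      (separator N).card + (separator M).card := by
  have h1 := Finset.card_sdiff_of_subset hN.1
  have h2 := Finset.card_sdiff_of_subset hM.1
  have h3 := Finset.card_sdiff_of_subset (hN.inf hM).1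
  have h4 := Finset.card_sdiff_of_subset (hN.sup hM).1
  have h5 := Finset.card_union_add_card_inter N.1 M.1
  have h6 := Finset.card_union_add_card_inter N.2 M.2
  have l1 := Finset.card_le_card hN.1
  have l2 := Finset.card_le_card hM.1
  have l3 := Finset.card_le_card (hN.inf hM).1
  have l4 := Finset.card_le_card (hN.sup hM).1
  change _ = (N.2 ∩ M.2).card - (N.1 ∩ M.1).card at h3
  change _ = (N.2 ∪ M.2).card - (N.1 ∪ M.1).card at h4
  change (N.1 ∩ M.1).card ≤ (N.2 ∩ M.2).card at l3
  change (N.1 ∪ M.1).card ≤ (N.2 ∪ M.2).card at l4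
  unfold separator
  omega

/-- Two nested separations `P ≤ Q` inside a region can be mixed along a union `C` of components of
the region: the separator of the mixture is that of `Q` within `C` and that of `P` outside `C`. -/
theorem exists_mixed_separation {L P Q R : Finset V × Finset V} {C : Finset V}
    (hL : IsSeparation G L) (hP : IsSeparation G P) (hQ : IsSeparation G Q)
    (hR : IsSeparation G R) (hLP : L ≤ P) (hPQ : P ≤ Q) (hQR : Q ≤ R)
    (hC : IsClosedIn G (region L R) C) :
    ∃ N, IsSeparation G N ∧ P ≤ N ∧ N ≤ Q ∧
      (separator N).card = (separator P \ C).card + (C ∩ separator Q).card := by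
  have a1 := hLP.1
  have a2 := hLP.2
  have b1 := hPQ.1
  have b2 := hPQ.2
  have c1 := hQR.1
  have c2 := hQR.2
  have hC1 := hC.1
  have hP1 := hP.1
  have hQ1 := hQ.1
  have hR1 := hR.1
  have hL1 := hL.1
  simp only [Finset.subset_iff, region, Finset.mem_sdiff] at *
  refine ⟨(P.1 ∪ (Q.1 ∩ C), P.2 ∪ (Q.2 ∩ C)), ⟨?_, ?_⟩, ⟨?_, ?_⟩, ⟨?_, ?_⟩, ?_⟩
  · intro x; simp only [Finset.mem_union, Finset.mem_inter]; grind
  · intro u hu w h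
    simp only [Finset.mem_union, Finset.mem_inter] at *
    rcases hu with hu | ⟨hu, huC⟩
    · exact Or.inl (hP.2 u hu w h)
    · have hw := hQ.2 u hu w h
      by_cases hwP : w ∈ P.2
      · exact Or.inl hwP
      · refine Or.inr ⟨hw, hC.2 u huC w ?_ h⟩
        rw [Finset.mem_sdiff]
        grind
  · intro x; simp only [Finset.mem_union, Finset.mem_inter]; grind
  · intro x; simp only [Finset.mem_union, Finset.mem_inter]; grind
  · intro x; simp only [Finset.mem_union, Finset.mem_inter]; grind
  · intro x; simp only [Finset.mem_union, Finset.mem_inter]; grind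
  · rw [← Finset.card_union_of_disjoint]
    · congr 1
      ext x
      simp only [separator, Finset.mem_union, Finset.mem_inter, Finset.mem_sdiff]
      grind
    · rw [Finset.disjoint_left]
      intro x
      simp only [Finset.mem_inter, Finset.mem_sdiff]
      tauto

variable (G) in
/-- A chain `N 0 ≤ ⋯ ≤ N T` of separations of order at most `k` that is lean: no separation
between two members has smaller order than all members between the two. In each step only one of
the two sides changes. -/
structure IsLeanChain (k T : ℕ) (N : ℕ → Finset V × Finset V) : Prop where
  isSeparation : ∀ m ≤ T, IsSeparation G (N m)
  mono : ∀ p q, p ≤ q → q ≤ T → N p ≤ N q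
  step : ∀ m < T, (N m).1 = (N (m + 1)).1 ∨ (N m).2 = (N (m + 1)).2
  card_le : ∀ m ≤ T, (separator (N m)).card ≤ k
  lean : ∀ p q, p ≤ q → q ≤ T → ∀ Q, IsSeparation G Q → N p ≤ Q → Q ≤ N q →
    ∃ m, p ≤ m ∧ m ≤ q ∧ (separator (N m)).card ≤ (separator Q).card

variable (G) in
/-- One step between separations of order at most `k`, changing only one side. -/
def ChainStep (k : ℕ) (N N' : Finset V × Finset V) : Prop :=
  IsSeparation G N ∧ IsSeparation G N' ∧ N < N' ∧ (N.1 = N'.1 ∨ N.2 = N'.2) ∧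
    (separator N).card ≤ k ∧ (separator N').card ≤ k

theorem ChainStep.le_of_reflTransGen {k : ℕ} {N N' : Finset V × Finset V}
    (h : Relation.ReflTransGen (ChainStep G k) N N') : N ≤ N' := by
  induction h with
  | refl => exact le_rfl
  | tail _ h ih => exact ih.trans h.2.2.1.le

/-- Taking infima with a separation `M` of minimum order turns a chain ending in `R` into a chain
ending in `M`. By submodularity of the order, the orders do not increase. -/
theorem reflTransGen_inf {k : ℕ} {L M R : Finset V × Finset V} (hM : IsSeparation G M)
    (hMR : M ≤ R)
    (hmin : ∀ Q, IsSeparation G Q → L ≤ Q → Q ≤ R → (separator M).card ≤ (separator Q).card)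
    {N : Finset V × Finset V} (h : Relation.ReflTransGen (ChainStep G k) N R) (hN : L ≤ N) :
    Relation.ReflTransGen (ChainStep G k) (N ⊓ M) M := by
  have key : ∀ N, IsSeparation G N → L ≤ N → N ≤ R → (separator N).card ≤ k →
      (separator (N ⊓ M)).card ≤ k := by
    intro N hN hLN hNR hk
    have := card_separator_inf_add_sup hN hM
    have := hmin _ (hN.sup hM) (hLN.trans le_sup_left) (sup_le hNR hMR)
    omega
  induction h using Relation.ReflTransGen.head_induction_on with
  | refl => rw [inf_eq_right.2 hMR]
  | @head N N' h h' ih =>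
    have hN' := hN.trans h.2.2.1.le
    have hR' := ChainStep.le_of_reflTransGen h'
    rcases (inf_le_inf_right M h.2.2.1.le).eq_or_lt with he | hlt
    · rw [he]; exact ih hN'
    · refine .head ⟨h.1.inf hM, h.2.1.inf hM, hlt, ?_, key _ h.1 hN (h.2.2.1.le.trans hR')
        h.2.2.2.2.1, key _ h.2.1 hN' hR' h.2.2.2.2.2⟩ (ih hN')
      exact h.2.2.2.1.imp (fun e => congrArg (· ∩ M.1) e) (fun e => congrArg (· ∩ M.2) e)

/-- The mirror image of `reflTransGen_inf`: suprema with `M` give a chain starting in `M`. -/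
theorem reflTransGen_sup {k : ℕ} {L M R : Finset V × Finset V} (hM : IsSeparation G M)
    (hLM : L ≤ M)
    (hmin : ∀ Q, IsSeparation G Q → L ≤ Q → Q ≤ R → (separator M).card ≤ (separator Q).card)
    {N : Finset V × Finset V} (h : Relation.ReflTransGen (ChainStep G k) L N) (hN : N ≤ R) :
    Relation.ReflTransGen (ChainStep G k) M (N ⊔ M) := by
  have key : ∀ N, IsSeparation G N → L ≤ N → N ≤ R → (separator N).card ≤ k →
      (separator (N ⊔ M)).card ≤ k := by
    intro N hN hLN hNR hk
    have := card_separator_inf_add_sup hN hM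
    have := hmin _ (hN.inf hM) (le_inf hLN hLM) (inf_le_left.trans hNR)
    omega
  induction h with
  | refl => rw [sup_eq_right.2 hLM]
  | @tail N N' h' h ih =>
    have hN' := h.2.2.1.le.trans hN
    have hL' := ChainStep.le_of_reflTransGen h'
    rcases (sup_le_sup_right h.2.2.1.le M).eq_or_lt with he | hlt
    · rw [← he]; exact ih hN'
    · refine .tail (ih hN') ⟨h.1.sup hM, h.2.1.sup hM, hlt, ?_, key _ h.1 hL' hN'
        h.2.2.2.2.1, key _ h.2.1 (hL'.trans h.2.2.1.le) hN h.2.2.2.2.2⟩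
      exact h.2.2.2.1.imp (fun e => congrArg (· ∪ M.1) e) (fun e => congrArg (· ∪ M.2) e)

theorem isLeanChain_singleton {k : ℕ} {L : Finset V × Finset V} (hL : IsSeparation G L)
    (hk : (separator L).card ≤ k) : IsLeanChain G k 0 fun _ => L where
  isSeparation _ _ := hL
  mono _ _ _ _ := le_rfl
  step _ h := absurd h (Nat.not_lt_zero _)
  card_le _ _ := hk
  lean p q hpq hq Q _ h1 h2 := ⟨p, le_rfl, hpq, by rw [le_antisymm h1 h2]⟩

theorem ChainStep.isLeanChain {k : ℕ} {L R : Finset V × Finset V} (h : ChainStep G k L R)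
    (hmin : ∀ Q, IsSeparation G Q → L ≤ Q → Q ≤ R →
      (separator L).card ≤ (separator Q).card ∨ (separator R).card ≤ (separator Q).card) :
    IsLeanChain G k 1 fun m => if m = 0 then L else R where
  isSeparation m _ := by split_ifs; exacts [h.1, h.2.1]
  mono p q hpq _ := by
    split_ifs
    exacts [le_rfl, h.2.2.1.le, by omega, le_rfl]
  step m hm := by
    obtain rfl : m = 0 := by omega
    exact h.2.2.2.1
  card_le m _ := by split_ifs; exacts [h.2.2.2.2.1, h.2.2.2.2.2]
  lean p q hpq hq Q hQ h1 h2 := by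
    by_cases hp : p = 0
    · by_cases hq' : q = 0
      · refine ⟨0, hp.le, hq'.ge, ?_⟩
        simp only [hp, hq', if_true] at h1 h2
        rw [le_antisymm h1 h2]
        rfl
      · simp only [hp, hq', if_true, if_false] at h1 h2
        rcases hmin Q hQ h1 h2 with h | h
        · exact ⟨0, hp.le, Nat.zero_le _, h⟩
        · exact ⟨1, by omega, by omega, h⟩
    · have hq' : q ≠ 0 := by omega
      simp only [hp, hq', if_false] at h1 h2
      exact ⟨q, hpq, le_rfl, by rw [le_antisymm h1 h2]; simp [hq']⟩

theorem IsLeanChain.concat {k S T : ℕ} {N N' : ℕ → Finset V × Finset V}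
    (h : IsLeanChain G k S N) (h' : IsLeanChain G k T N') (he : N S = N' 0)
    (hcross : ∀ p < S, ∀ q ≤ T, ∀ Q, IsSeparation G Q → N p ≤ Q → Q ≤ N' q →
      (∃ m, p ≤ m ∧ m ≤ S ∧ (separator (N m)).card ≤ (separator Q).card) ∨
      ∃ m ≤ q, (separator (N' m)).card ≤ (separator Q).card) :
    ∃ N'', IsLeanChain G k (S + T) N'' ∧ N'' 0 = N 0 ∧ N'' (S + T) = N' T := by
  let f : ℕ → Finset V × Finset V := fun m => if m < S then N m else N' (m - S)
  have f1 : ∀ m ≤ S, f m = N m := by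
    intro m hm
    rcases hm.eq_or_lt with rfl | hm
    · simp [f, he]
    · simp [f, hm]
  have f2 : ∀ m, f (S + m) = N' m := fun m => by simp [f]
  have hf : ∀ m, S ≤ m → ∃ n, m = S + n := fun m hm => ⟨m - S, by omega⟩
  refine ⟨f, ⟨?_, ?_, ?_, ?_, ?_⟩, f1 0 (Nat.zero_le _), f2 T⟩
  · intro m hm
    rcases le_total m S with hmS | hmS
    · rw [f1 m hmS]; exact h.isSeparation m hmS
    · obtain ⟨n, rfl⟩ := hf m hmS
      rw [f2]; exact h'.isSeparation n (by omega)
  · intro p q hpq hq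
    rcases le_total q S with hqS | hqS
    · rw [f1 q hqS, f1 p (hpq.trans hqS)]; exact h.mono p q hpq hqS
    · obtain ⟨n, rfl⟩ := hf q hqS
      rw [f2]
      rcases le_total p S with hpS | hpS
      · rw [f1 p hpS]
        exact (h.mono p S hpS le_rfl).trans (he.le.trans (h'.mono 0 n (Nat.zero_le _) (by omega)))
      · obtain ⟨l, rfl⟩ := hf p hpS
        rw [f2]; exact h'.mono l n (by omega) (by omega)
  · intro m hm
    rcases lt_or_ge m S with hmS | hmS
    · rw [f1 m hmS.le, f1 (m + 1) hmS]; exact h.step m hmS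
    · obtain ⟨n, rfl⟩ := hf m hmS
      rw [add_assoc, f2, f2]; exact h'.step n (by omega)
  · intro m hm
    rcases le_total m S with hmS | hmS
    · rw [f1 m hmS]; exact h.card_le m hmS
    · obtain ⟨n, rfl⟩ := hf m hmS
      rw [f2]; exact h'.card_le n (by omega)
  · intro p q hpq hq Q hQ h1 h2
    rcases le_total q S with hqS | hqS
    · rw [f1 q hqS] at h2
      rw [f1 p (hpq.trans hqS)] at h1
      obtain ⟨m, hm1, hm2, hm⟩ := h.lean p q hpq hqS Q hQ h1 h2
      exact ⟨m, hm1, hm2, by rwa [f1 m (hm2.trans hqS)]⟩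
    · obtain ⟨n, rfl⟩ := hf q hqS
      rw [f2] at h2
      rcases lt_or_ge p S with hpS | hpS
      · rw [f1 p hpS.le] at h1
        rcases hcross p hpS n (by omega) Q hQ h1 h2 with ⟨m, hm1, hm2, hm⟩ | ⟨m, hm1, hm⟩
        · exact ⟨m, hm1, by omega, by rwa [f1 m hm2]⟩
        · exact ⟨S + m, by omega, by omega, by rwa [f2]⟩
      · obtain ⟨l, rfl⟩ := hf p hpS
        rw [f2] at h1
        obtain ⟨m, hm1, hm2, hm⟩ := h'.lean l n (by omega) (by omega) Q hQ h1 h2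
        exact ⟨S + m, by omega, by omega, by rwa [f2]⟩

/-- Between two separations joined by a chain of separations of order at most `k` there is a lean
one: split at a separation of minimum order, or take off the first or the last member if the
minimum is attained there. -/
theorem exists_isLeanChain [Fintype V] {k : ℕ} {L R : Finset V × Finset V}
    (hL : IsSeparation G L) (hk : (separator L).card ≤ k)
    (h : Relation.ReflTransGen (ChainStep G k) L R) :
    ∃ T N, IsLeanChain G k T N ∧ N 0 = L ∧ N T = R := by
  classical
  let rank : Finset V × Finset V → ℕ := fun N => N.1.card + N.2.card
  have hrank : ∀ {N N' : Finset V × Finset V}, N < N' → rank N < rank N' := by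
    intro N N' h
    rcases Prod.lt_iff.1 h with ⟨h1, h2⟩ | ⟨h1, h2⟩
    · exact add_lt_add_of_lt_of_le (Finset.card_lt_card h1) (Finset.card_le_card h2)
    · exact add_lt_add_of_le_of_lt (Finset.card_le_card h1) (Finset.card_lt_card h2)
  have key : ∀ n, ∀ L R : Finset V × Finset V, rank R ≤ rank L + n → IsSeparation G L →
      (separator L).card ≤ k → Relation.ReflTransGen (ChainStep G k) L R →
      ∃ T N, IsLeanChain G k T N ∧ N 0 = L ∧ N T = R := by
    intro n
    induction n with
    | zero =>
      intro L R hn hL hk h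
      rcases (ChainStep.le_of_reflTransGen h).eq_or_lt with rfl | hlt
      · exact ⟨0, _, isLeanChain_singleton hL hk, rfl, rfl⟩
      · have := hrank hlt
        omega
    | succ n ih =>
      intro L R hn hL hk h
      have hLR := ChainStep.le_of_reflTransGen h
      obtain ⟨M, hM, hmin⟩ := Finset.exists_min_image
        (Finset.univ.filter fun Q => IsSeparation G Q ∧ L ≤ Q ∧ Q ≤ R)
        (fun Q => (separator Q).card) ⟨L, by simp [hL, hLR]⟩
      simp only [Finset.mem_filter, Finset.mem_univ, true_and] at hM hmin
      obtain ⟨hM, hLM, hMR⟩ := hM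
      have hmin' : ∀ Q, IsSeparation G Q → L ≤ Q → Q ≤ R →
          (separator M).card ≤ (separator Q).card := fun Q h1 h2 h3 => hmin Q ⟨h1, h2, h3⟩
      rcases hLM.eq_or_lt with rfl | hLM'
      · rcases Relation.ReflTransGen.cases_head h with rfl | ⟨L', hs, h'⟩
        · exact ⟨0, _, isLeanChain_singleton hL hk, rfl, rfl⟩
        · have := hrank hs.2.2.1
          have hLR' := ChainStep.le_of_reflTransGen h'
          obtain ⟨T, N, hN, h0, hT⟩ := ih L' R (by omega) hs.2.1 hs.2.2.2.2.2 h'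
          obtain ⟨N', hN', h0', hT'⟩ := (hs.isLeanChain fun Q hQ h1 h2 =>
            Or.inl (hmin' Q hQ h1 (h2.trans hLR'))).concat hN (by simp [h0]) (by
              intro p hp q hq Q hQ h1 h2
              obtain rfl : p = 0 := by omega
              refine Or.inl ⟨0, le_rfl, Nat.zero_le _, hmin' Q hQ h1 (h2.trans ?_)⟩
              exact (hN.mono q T hq le_rfl).trans hT.le)
          exact ⟨_, N', hN', h0', hT'.trans hT⟩
      · rcases hMR.eq_or_lt with rfl | hMR'
        · rcases Relation.ReflTransGen.cases_tail h with rfl | ⟨R', h', hs⟩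
          · exact ⟨0, _, isLeanChain_singleton hL hk, rfl, rfl⟩
          · have := hrank hs.2.2.1
            have hLR' := ChainStep.le_of_reflTransGen h'
            obtain ⟨T, N, hN, h0, hT⟩ := ih L R' (by omega) hL hk h'
            obtain ⟨N', hN', h0', hT'⟩ := hN.concat (hs.isLeanChain fun Q hQ h1 h2 =>
              Or.inr (hmin' Q hQ (hLR'.trans h1) h2)) (by simp [hT]) (by
                intro p hp q hq Q hQ h1 h2
                have hQL : L ≤ Q := h0.ge.trans ((hN.mono 0 p (Nat.zero_le _) hp.le).trans h1)
                by_cases hq0 : q = 0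
                · subst hq0
                  simp only [if_true] at h2
                  rw [← hT] at h2
                  obtain ⟨m, hm1, hm2, hm⟩ := hN.lean p T hp.le le_rfl Q hQ h1 h2
                  exact Or.inl ⟨m, hm1, hm2, hm⟩
                · simp only [hq0, if_false] at h2
                  exact Or.inr ⟨1, by omega, hmin' Q hQ hQL h2⟩)
            exact ⟨_, N', hN', h0'.trans h0, hT'⟩
        · have r1 := hrank hLM'
          have r2 := hrank hMR'
          have hkM : (separator M).card ≤ k := (hmin' L hL le_rfl hLR).trans hk
          have c1 := reflTransGen_inf hM hMR hmin' h le_rfl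
          rw [inf_eq_left.2 hLM] at c1
          have c2 := reflTransGen_sup hM hLM hmin' h le_rfl
          rw [sup_eq_left.2 hMR] at c2
          obtain ⟨S, N, hN, h0, hS⟩ := ih L M (by omega) hL hk c1
          obtain ⟨T, N', hN', h0', hT⟩ := ih M R (by omega) hM hkM c2
          obtain ⟨N'', hN'', h0'', hT''⟩ := hN.concat hN' (hS.trans h0'.symm) (by
            intro p hp q hq Q hQ h1 h2
            refine Or.inr ⟨0, Nat.zero_le _, ?_⟩
            rw [h0']
            exact hmin' Q hQ (h0.ge.trans ((hN.mono 0 p (Nat.zero_le _) hp.le).trans h1))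
              (h2.trans ((hN'.mono q T hq le_rfl).trans hT.le)))
          exact ⟨_, N'', hN'', h0''.trans h0, hT''.trans hT⟩
  exact key (rank R) L R (by omega) hL hk h

/-! ### Exploring the regions of a lean chain -/

theorem separator_subset_region {L P R : Finset V × Finset V} (hLP : L ≤ P) (hPR : P ≤ R) :
    separator P ⊆ region L R :=
  Finset.sdiff_subset_sdiff hPR.2 hLP.1

/-- In a lean chain, if the separator of `N p` is smallest among those of `N p, …, N q`, then within
every union of components it has at most as many vertices as that of `N q`: otherwise mixing the
two separations would contradict leanness. -/
theorem IsLeanChain.card_inter_le_right {k T : ℕ} {N : ℕ → Finset V × Finset V}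
    (h : IsLeanChain G k T N) {i p q j : ℕ} (hip : i ≤ p) (hpq : p ≤ q) (hqj : q ≤ j)
    (hj : j ≤ T) {C : Finset V} (hC : IsClosedIn G (region (N i) (N j)) C)
    (hmin : ∀ m, p ≤ m → m ≤ q → (separator (N p)).card ≤ (separator (N m)).card) :
    (C ∩ separator (N p)).card ≤ (C ∩ separator (N q)).card := by
  obtain ⟨Q, hQ, h1, h2, hc⟩ := exists_mixed_separation (h.isSeparation i (by omega))
    (h.isSeparation p (by omega)) (h.isSeparation q (by omega)) (h.isSeparation j hj)
    (h.mono i p hip (by omega)) (h.mono p q hpq (by omega)) (h.mono q j hqj hj) hC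
  obtain ⟨m, hm1, hm2, hm⟩ := h.lean p q hpq (by omega) Q hQ h1 h2
  have := hmin m hm1 hm2
  have := Finset.card_sdiff_add_card_inter (separator (N p)) C
  rw [Finset.inter_comm _ C] at this
  omega

/-- The mirror image of `IsLeanChain.card_inter_le_right`. -/
theorem IsLeanChain.card_inter_le_left {k T : ℕ} {N : ℕ → Finset V × Finset V}
    (h : IsLeanChain G k T N) {i p q j : ℕ} (hip : i ≤ p) (hpq : p ≤ q) (hqj : q ≤ j)
    (hj : j ≤ T) {C : Finset V} (hC : IsClosedIn G (region (N i) (N j)) C)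
    (hmin : ∀ m, p ≤ m → m ≤ q → (separator (N q)).card ≤ (separator (N m)).card) :
    (C ∩ separator (N q)).card ≤ (C ∩ separator (N p)).card := by
  obtain ⟨Q, hQ, h1, h2, hc⟩ := exists_mixed_separation (h.isSeparation i (by omega))
    (h.isSeparation p (by omega)) (h.isSeparation q (by omega)) (h.isSeparation j hj)
    (h.mono i p hip (by omega)) (h.mono p q hpq (by omega)) (h.mono q j hqj hj)
    ((isClosedIn_self _).sdiff hC)
  obtain ⟨m, hm1, hm2, hm⟩ := h.lean p q hpq (by omega) Q hQ h1 h2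
  have := hmin m hm1 hm2
  have h3 := separator_subset_region (h.mono i p hip (by omega)) (h.mono p j (by omega) hj)
  have h4 := separator_subset_region (h.mono i q (by omega) (by omega)) (h.mono q j hqj hj)
  have e1 : separator (N p) \ (region (N i) (N j) \ C) = C ∩ separator (N p) := by
    ext x
    have := @h3 x
    simp only [Finset.mem_sdiff, Finset.mem_inter]
    tauto
  have e2 : (region (N i) (N j) \ C) ∩ separator (N q) = separator (N q) \ C := by
    ext x
    have := @h4 x
    simp only [Finset.mem_sdiff, Finset.mem_inter]
    tauto
  rw [e1, e2] at hc
  have := Finset.card_sdiff_add_card_inter (separator (N q)) C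
  rw [Finset.inter_comm _ C] at this
  omega

/-- The budget left for `K` suffices for a separator `X` that, outside `K`, is at least as large as
the middle separator `M`. -/
theorem card_inter_le_sub {C K M X : Finset V} {κ : ℕ} (hK : K ⊆ C)
    (hF : ((C ∩ M) \ K).card ≤ ((C ∩ X) \ K).card) (hκ : (C ∩ X).card ≤ κ) :
    (K ∩ X).card ≤ κ - ((C ∩ M) \ K).card := by
  have h := Finset.card_sdiff_add_card_inter (C ∩ X) K
  have : C ∩ X ∩ K = K ∩ X := by
    ext x
    have := @hK x
    simp only [Finset.mem_inter]
    tauto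
  rw [this] at h
  omega

/-- Every component of a region of a lean chain whose end separators are no larger than the inner
ones can be explored from either end, where `κ` bounds the number of vertices that it shares with
each separator. By induction, the region is split at a smallest inner separator. -/
theorem IsLeanChain.solvable {k T : ℕ} {N : ℕ → Finset V × Finset V}
    (h : IsLeanChain G k T N) (n : ℕ) : ∀ i j, i ≤ j → j ≤ T → j - i ≤ n →
    (∀ m, i < m → m < j → (separator (N i)).card ≤ (separator (N m)).card ∧
      (separator (N j)).card ≤ (separator (N m)).card) →
    ∀ C, IsComponentOf G (region (N i) (N j)) C →
    ∀ κ, (∀ m, i ≤ m → m ≤ j → (C ∩ separator (N m)).card ≤ κ) →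
      Solvable G (separator (N i)) (separator (N j)) C κ ∧
      Solvable G (separator (N j)) (separator (N i)) C κ := by
  induction n with
  | zero =>
    intro i j hij hj hn _ C hC κ hκ
    obtain rfl : i = j := by omega
    have : C.card ≤ κ := by
      have := hκ i le_rfl le_rfl
      rwa [Finset.inter_eq_left.2 (show C ⊆ separator (N i) from hC.1.1)] at this
    exact ⟨solvable_of_card_le hC.2 this, solvable_of_card_le hC.2 this⟩
  | succ n ih =>
    intro i j hij hj hn hmin C hC κ hκ
    rcases Nat.lt_or_ge (i + 1) j with hlt | hge
    swap
    · -- the region is one of the two end separators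
      have : C.card ≤ κ := by
        rcases hij.eq_or_lt with rfl | hlt
        · have := hκ i le_rfl le_rfl
          rwa [Finset.inter_eq_left.2 (show C ⊆ separator (N i) from hC.1.1)] at this
        · obtain rfl : j = i + 1 := by omega
          rcases h.step i (by omega) with he | he
          · have := hκ (i + 1) (by omega) le_rfl
            have hr : region (N i) (N (i + 1)) = separator (N (i + 1)) := by
              rw [region, separator, he]
            rwa [Finset.inter_eq_left.2 (hr ▸ hC.1.1)] at this
          · have := hκ i le_rfl (by omega)
            have hr : region (N i) (N (i + 1)) = separator (N i) := by
              rw [region, separator, he]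
            rwa [Finset.inter_eq_left.2 (hr ▸ hC.1.1)] at this
      exact ⟨solvable_of_card_le hC.2 this, solvable_of_card_le hC.2 this⟩
    obtain ⟨c, hc, hcmin⟩ := Finset.exists_min_image (Finset.Ioo i j)
      (fun m => (separator (N m)).card) ⟨i + 1, by simp; omega⟩
    rw [Finset.mem_Ioo] at hc
    obtain ⟨hic, hcj⟩ := hc
    have hcmin : ∀ m, i < m → m < j → (separator (N c)).card ≤ (separator (N m)).card :=
      fun m h1 h2 => hcmin m (Finset.mem_Ioo.2 ⟨h1, h2⟩)
    have lic := h.mono i c hic.le (by omega)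
    have lcj := h.mono c j hcj.le hj
    have hsub₁ : region (N i) (N c) ⊆ region (N i) (N j) :=
      Finset.sdiff_subset_sdiff lcj.2 subset_rfl
    have hsub₂ : region (N c) (N j) ⊆ region (N i) (N j) :=
      Finset.sdiff_subset_sdiff subset_rfl lic.1
    have hcl₁ := hC.1.inter_of_subset hsub₁
    have hcl₂ := hC.1.inter_of_subset hsub₂
    have hci := hmin c hic hcj
    -- the end separators are dominated by the middle one
    have dom₁ : ∀ m, i ≤ m → m ≤ c → (separator (N i)).card ≤ (separator (N m)).card := by
      intro m h1 h2
      rcases h1.eq_or_lt with rfl | h1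
      · exact le_rfl
      · exact (hmin m h1 (by omega)).1
    have dom₂ : ∀ m, c ≤ m → m ≤ j → (separator (N j)).card ≤ (separator (N m)).card := by
      intro m h1 h2
      rcases h2.eq_or_lt with rfl | h2
      · exact le_rfl
      · exact (hmin m (by omega) h2).2
    have link₁ : ∀ F, IsClosedIn G (C ∩ region (N i) (N c)) F →
        (F ∩ separator (N i)).card ≤ (F ∩ separator (N c)).card := fun F hF =>
      h.card_inter_le_right le_rfl hic.le le_rfl (by omega) (hcl₁.trans hF) dom₁
    have link₂ : ∀ F, IsClosedIn G (C ∩ region (N c) (N j)) F →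
        (F ∩ separator (N j)).card ≤ (F ∩ separator (N c)).card := fun F hF =>
      h.card_inter_le_left le_rfl hcj.le le_rfl hj (hcl₂.trans hF) dom₂
    have hκc := hκ c hic.le hcj.le
    have sub₁ : separator (N c) ⊆ region (N i) (N c) := separator_subset_region lic le_rfl
    have sub₂ : separator (N c) ⊆ region (N c) (N j) := separator_subset_region le_rfl lcj
    have bound₁ : ∀ K, IsComponentOf G (C ∩ region (N i) (N c)) K → ∀ m, i ≤ m → m ≤ c →
        (K ∩ separator (N m)).card ≤ κ - ((C ∩ separator (N c)) \ K).card := by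
      intro K hK
      have hKC : K ⊆ C := hK.1.1.trans Finset.inter_subset_left
      have main : ∀ m, i < m → m ≤ c →
          (K ∩ separator (N m)).card ≤ κ - ((C ∩ separator (N c)) \ K).card := by
        intro m h1 h2
        refine card_inter_le_sub hKC ?_ (hκ m h1.le (by omega))
        have := h.card_inter_le_left h1.le h2 le_rfl (by omega)
          (hcl₁.trans ((isClosedIn_self _).sdiff hK.1))
          (fun m' h3 h4 => hcmin m' (by omega) (by omega))
        refine (Finset.card_le_card ?_).trans (this.trans (Finset.card_le_card ?_))
        · intro x
          have := @sub₁ x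
          simp only [Finset.mem_sdiff, Finset.mem_inter]
          tauto
        · intro x
          simp only [Finset.mem_sdiff, Finset.mem_inter]
          tauto
      intro m h1 h2
      rcases h1.eq_or_lt with rfl | h1
      · exact (link₁ K hK.1).trans (main c hic le_rfl)
      · exact main m h1 h2
    have bound₂ : ∀ K, IsComponentOf G (C ∩ region (N c) (N j)) K → ∀ m, c ≤ m → m ≤ j →
        (K ∩ separator (N m)).card ≤ κ - ((C ∩ separator (N c)) \ K).card := by
      intro K hK
      have hKC : K ⊆ C := hK.1.1.trans Finset.inter_subset_left
      have main : ∀ m, c ≤ m → m < j →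
          (K ∩ separator (N m)).card ≤ κ - ((C ∩ separator (N c)) \ K).card := by
        intro m h1 h2
        refine card_inter_le_sub hKC ?_ (hκ m (by omega) h2.le)
        have := h.card_inter_le_right le_rfl h1 h2.le hj
          (hcl₂.trans ((isClosedIn_self _).sdiff hK.1))
          (fun m' h3 h4 => hcmin m' (by omega) (by omega))
        refine (Finset.card_le_card ?_).trans (this.trans (Finset.card_le_card ?_))
        · intro x
          have := @sub₂ x
          simp only [Finset.mem_sdiff, Finset.mem_inter]
          tauto
        · intro x
          simp only [Finset.mem_sdiff, Finset.mem_inter]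
          tauto
      intro m h1 h2
      rcases h2.eq_or_lt with rfl | h2
      · exact (link₂ K hK.1).trans (main c le_rfl hcj)
      · exact main m h1 h2
    have ih₁ : ∀ K, IsComponentOf G (C ∩ region (N i) (N c)) K → _ := fun K hK =>
      ih i c hic.le (by omega) (by omega)
        (fun m h1 h2 => ⟨(hmin m h1 (by omega)).1, hcmin m h1 (by omega)⟩) K
        ⟨hcl₁.trans hK.1, hK.2⟩ _ (bound₁ K hK)
    have ih₂ : ∀ K, IsComponentOf G (C ∩ region (N c) (N j)) K → _ := fun K hK =>
      ih c j hcj.le hj (by omega)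
        (fun m h1 h2 => ⟨hcmin m (by omega) h2, (hmin m (by omega) h2).2⟩) K
        ⟨hcl₂.trans hK.1, hK.2⟩ _ (bound₂ K hK)
    have hedge : ∀ u ∈ C, ∀ w ∈ C, G.Adj u w →
        u ∈ C ∩ region (N i) (N c) ∧ w ∈ C ∩ region (N i) (N c) ∨
        u ∈ C ∩ region (N c) (N j) ∧ w ∈ C ∩ region (N c) (N j) := by
      intro u hu w hw huw
      have hs := (h.isSeparation c (by omega))
      have hu' := hC.1.1 hu
      have hw' := hC.1.1 hw
      have s1 := @hs.1 u
      have s2 := @hs.1 w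
      have s3 := hs.2 u
      have s4 := hs.2 w
      simp only [region, Finset.mem_inter, Finset.mem_sdiff] at hu' hw' ⊢
      have s5 := fun hu => s3 hu w huw
      have s6 := fun hw => s4 hw u huw.symm
      clear s3 s4
      grind
    have hMM : ∀ x ∈ C ∩ region (N i) (N c), x ∈ C ∩ region (N c) (N j) →
        x ∈ separator (N c) := by
      intro x
      simp only [region, separator, Finset.mem_inter, Finset.mem_sdiff]
      tauto
    have hLL : ∀ x ∈ C, x ∈ separator (N i) → x ∈ C ∩ region (N i) (N c) := fun x hx hx' =>
      Finset.mem_inter.2 ⟨hx, separator_subset_region le_rfl lic hx'⟩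
    have hRR : ∀ x ∈ C, x ∈ separator (N j) → x ∈ C ∩ region (N c) (N j) := fun x hx hx' =>
      Finset.mem_inter.2 ⟨hx, separator_subset_region lcj le_rfl hx'⟩
    constructor
    · exact Solvable.glue hC.2 Finset.inter_subset_left Finset.inter_subset_left hMM hedge hLL hRR
        link₁ link₂ hκc (fun K hK => (ih₁ K hK).1) (fun K hK => (ih₁ K hK).2)
        (fun K hK => (ih₂ K hK).1)
    · exact Solvable.glue hC.2 Finset.inter_subset_left Finset.inter_subset_left
        (fun x hx hx' => hMM x hx' hx) (fun u hu w hw huw => (hedge u hu w hw huw).symm) hRR hLL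
        link₂ link₁ hκc (fun K hK => (ih₂ K hK).2) (fun K hK => (ih₂ K hK).1)
        (fun K hK => (ih₁ K hK).2)

/-! ### From path decompositions to chains of separations and back -/

theorem isComponentOf_univ [Fintype V] (hG : G.Connected) :
    IsComponentOf G Finset.univ (Finset.univ : Finset V) := by
  obtain ⟨v⟩ := hG.nonempty
  obtain ⟨K, hvK, hK⟩ := exists_isComponentOf (G := G) (Finset.mem_univ v)
  have := hK.1.eq_univ hG hvK
  rwa [this] at hK

theorem ChainStep.reflTransGen_of_le {k : ℕ} {N N' : Finset V × Finset V} (hN : IsSeparation G N)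
    (hN' : IsSeparation G N') (hle : N ≤ N') (h : N.1 = N'.1 ∨ N.2 = N'.2)
    (hk : (separator N).card ≤ k) (hk' : (separator N').card ≤ k) :
    Relation.ReflTransGen (ChainStep G k) N N' := by
  rcases hle.eq_or_lt with rfl | hlt
  · exact .refl
  · exact .single ⟨hN, hN', hlt, h, hk, hk'⟩

/-- A path decomposition gives a chain of separations from the trivial one with empty left side
to the trivial one with empty right side. -/
theorem reflTransGen_of_pathDecomposition [Fintype V] (P : PathDecomposition G) {k : ℕ}
    (hk : ∀ i, (P.bag i).card ≤ k) :
    Relation.ReflTransGen (ChainStep G k) (∅, ∅) (Finset.univ, Finset.univ) := by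
  classical
  -- `A m` is the union of the bags before `m`, and `D m` is the set of vertices in no later bag;
  -- the chain alternates between `(D m, A m)` and `(D m, A (m + 1))`
  let A : ℕ → Finset V := fun m => Finset.univ.filter fun v => ∃ i : Fin P.d, i.1 < m ∧ v ∈ P.bag i
  let D : ℕ → Finset V := fun m =>
    Finset.univ.filter fun v => ∀ i : Fin P.d, m ≤ i.1 → v ∉ P.bag i
  have memA : ∀ m v, v ∈ A m ↔ ∃ i : Fin P.d, i.1 < m ∧ v ∈ P.bag i := fun m v => by simp [A]
  have memD : ∀ m v, v ∈ D m ↔ ∀ i : Fin P.d, m ≤ i.1 → v ∉ P.bag i := fun m v => by simp [D]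
  have sepD : ∀ m l, m ≤ l → IsSeparation G (D m, A l) := by
    intro m l hml
    refine ⟨fun v hv => ?_, fun u hu w h => ?_⟩
    · obtain ⟨i, hi⟩ := P.exists_mem_bag v
      refine (memA _ _).2 ⟨i, ?_, hi⟩
      by_contra hlt
      exact (memD _ _).1 hv i (by omega) hi
    · obtain ⟨i, hi, hi'⟩ := P.exists_edge_bag u w h
      refine (memA _ _).2 ⟨i, ?_, hi'⟩
      by_contra hlt
      exact (memD _ _).1 hu i (by omega) hi
  have cardD : ∀ m l, l ≤ m + 1 → (separator (D m, A l)).card ≤ k := by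
    intro m l hl
    by_cases hm : m < P.d
    · refine (Finset.card_le_card ?_).trans (hk ⟨m, hm⟩)
      intro v hv
      simp only [separator, Finset.mem_sdiff, memA, memD, not_forall, not_not] at hv
      obtain ⟨⟨i, hi, hvi⟩, i', hi', hvi'⟩ := hv
      exact P.mem_bag_of_le_of_le i ⟨m, hm⟩ i' (Fin.le_def.2 (by simp; omega))
        (Fin.le_def.2 hi') v hvi hvi'
    · have : separator (D m, A l) = ∅ := by
        refine Finset.eq_empty_of_forall_notMem fun v hv => ?_
        simp only [separator, Finset.mem_sdiff, memA, memD, not_forall, not_not] at hv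
        obtain ⟨_, i', hi', _⟩ := hv
        exact absurd i'.2 (by omega)
      simp [this]
  have monoA : ∀ m, A m ⊆ A (m + 1) := fun m v hv => by
    obtain ⟨i, hi, h⟩ := (memA _ _).1 hv
    exact (memA _ _).2 ⟨i, by omega, h⟩
  have monoD : ∀ m, D m ⊆ D (m + 1) := fun m v hv =>
    (memD _ _).2 fun i hi => (memD _ _).1 hv i (by omega)
  have key : ∀ m, Relation.ReflTransGen (ChainStep G k) (D 0, A 0) (D m, A m) := by
    intro m
    induction m with
    | zero => exact .refl
    | succ m ih =>
      refine (ih.trans (ChainStep.reflTransGen_of_le (N' := (D m, A (m + 1)))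
        (sepD _ _ le_rfl) (sepD _ _ (Nat.le_succ m)) ⟨subset_rfl, monoA m⟩ (Or.inl rfl)
        (cardD _ _ (by omega)) (cardD _ _ le_rfl))).trans
        (ChainStep.reflTransGen_of_le (sepD _ _ (Nat.le_succ m)) (sepD _ _ le_rfl)
          ⟨monoD m, subset_rfl⟩ (Or.inr rfl) (cardD _ _ le_rfl) (cardD _ _ (by omega)))
  have hA0 : A 0 = ∅ := Finset.eq_empty_of_forall_notMem fun v hv => by
    obtain ⟨i, hi, _⟩ := (memA _ _).1 hv
    omega
  have hD0 : D 0 = ∅ := Finset.subset_empty.1 ((sepD 0 0 le_rfl).1.trans hA0.le)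
  have hDd : D P.d = Finset.univ := Finset.eq_univ_of_forall fun v =>
    (memD _ _).2 fun i hi => absurd i.2 (by omega)
  have hAd : A P.d = Finset.univ :=
    Finset.univ_subset_iff.1 (hDd.ge.trans (sepD _ _ le_rfl).1)
  have := key P.d
  rwa [hA0, hD0, hAd, hDd] at this

/-- The chain can be made to start with a separator that is a single vertex. -/
theorem exists_reflTransGen_singleton {k : ℕ} {N R : Finset V × Finset V}
    (h : Relation.ReflTransGen (ChainStep G k) N R) (hN : N.2 = ∅) (hN' : N.1 = ∅)
    (hR : R.2 ≠ ∅) :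
    ∃ v, Relation.ReflTransGen (ChainStep G k) (∅, {v}) R := by
  induction h using Relation.ReflTransGen.head_induction_on with
  | refl => exact absurd hN hR
  | @head N N' h h' ih =>
    by_cases hN2 : N'.2 = ∅
    · exact ih hN2 (Finset.subset_empty.1 (h.2.1.1.trans hN2.le))
    · have h1 : N'.1 = ∅ := by
        rcases h.2.2.2.1 with he | he
        · rw [← he, hN']
        · exact absurd (he ▸ hN) hN2
      obtain ⟨v, hv⟩ := Finset.nonempty_iff_ne_empty.2 hN2
      refine ⟨v, (ChainStep.reflTransGen_of_le ?_ h.2.1 ?_ (Or.inl h1.symm) ?_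
        h.2.2.2.2.2).trans h'⟩
      · exact ⟨Finset.empty_subset _, fun u hu => absurd hu (Finset.notMem_empty u)⟩
      · exact ⟨Finset.empty_subset _, Finset.singleton_subset_iff.2 hv⟩
      · refine le_trans ?_ h.2.2.2.2.2
        simp only [separator, h1, Finset.sdiff_empty, Finset.card_singleton]
        exact Finset.card_pos.2 ⟨v, hv⟩

/-- The chain can be made to end with a separator that is a single vertex. -/
theorem exists_reflTransGen_erase [Fintype V] {k : ℕ} {L R : Finset V × Finset V}
    (h : Relation.ReflTransGen (ChainStep G k) L R) (hR : R.1 = Finset.univ)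
    (hR' : R.2 = Finset.univ) (hL : L.1 ≠ Finset.univ) :
    ∃ w, Relation.ReflTransGen (ChainStep G k) L (Finset.univ.erase w, Finset.univ) := by
  induction h with
  | refl => exact absurd hR hL
  | @tail N R h' h ih =>
    by_cases hN1 : N.1 = Finset.univ
    · exact ih hN1 (Finset.univ_subset_iff.1 (hN1.ge.trans h.1.1))
    · have h2 : N.2 = Finset.univ := by
        rcases h.2.2.2.1 with he | he
        · exact absurd (he.trans hR) hN1
        · rw [he, hR']
      obtain ⟨w, hw⟩ : ∃ w, w ∉ N.1 := by
        by_contra hcon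
        push Not at hcon
        exact hN1 (Finset.eq_univ_of_forall hcon)
      refine ⟨w, h'.trans (ChainStep.reflTransGen_of_le h.1 ?_ ?_ (Or.inr h2) h.2.2.2.2.1 ?_)⟩
      · exact ⟨Finset.subset_univ _, fun _ _ _ _ => Finset.mem_univ _⟩
      · exact ⟨fun x hx => Finset.mem_erase.2 ⟨fun e => hw (e ▸ hx), Finset.mem_univ _⟩,
          Finset.subset_univ _⟩
      · refine le_trans ?_ h.2.2.2.2.1
        have : separator (Finset.univ.erase w, (Finset.univ : Finset V)) = {w} := by
          ext x
          simp [separator]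
        rw [this, Finset.card_singleton]
        exact Finset.card_pos.2 ⟨w, Finset.mem_sdiff.2 ⟨h2 ▸ Finset.mem_univ w, hw⟩⟩

/-- A connected graph with a path decomposition into bags of at most `k` vertices can be explored
from some vertex so that every explored set has at most `2 * k - 1` vertices with unexplored
neighbours. -/
theorem exists_grow [Fintype V] (hG : G.Connected) (P : PathDecomposition G) {k : ℕ}
    (hk : ∀ i, (P.bag i).card ≤ k) :
    ∃ v Z, Grow G Finset.univ Z (2 * k - 1) {v} Finset.univ := by
  have hne := hG.nonempty
  obtain ⟨v, hv⟩ := exists_reflTransGen_singleton (reflTransGen_of_pathDecomposition P hk) rfl rfl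
    Finset.univ_nonempty.ne_empty
  obtain ⟨w, hw⟩ := exists_reflTransGen_erase hv rfl rfl Finset.univ_nonempty.ne_empty.symm
  have hL : IsSeparation G (∅, {v}) :=
    ⟨Finset.empty_subset _, fun u hu => absurd hu (Finset.notMem_empty u)⟩
  have sepL : separator (∅, ({v} : Finset V)) = {v} := by simp [separator]
  have sepR : separator (Finset.univ.erase w, (Finset.univ : Finset V)) = {w} := by
    ext x
    simp [separator]
  have hk1 : 1 ≤ k := by
    obtain ⟨i, hi⟩ := P.exists_mem_bag v
    exact (Finset.card_pos.2 ⟨v, hi⟩).trans_le (hk i)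
  obtain ⟨T, N, hN, h0, hT⟩ := exists_isLeanChain hL (by rw [sepL]; exact hk1) hw
  have hC := isComponentOf_univ hG
  -- as `G` is connected, separators with both `v` on the left and `w` on the right are nonempty
  have hpos : ∀ m ≤ T, 1 ≤ (separator (N m)).card := by
    intro m hm
    by_contra hlt
    have hemp : (N m).2 ⊆ (N m).1 := by
      rw [← Finset.sdiff_eq_empty_iff_subset, ← Finset.card_eq_zero]
      have : (separator (N m)).card = 0 := by omega
      exact this
    have h1 := h0.ge.trans (hN.mono 0 m (Nat.zero_le _) hm)
    have h2 := (hN.mono m T hm le_rfl).trans hT.le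
    have hv1 : v ∈ (N m).1 := hemp (h1.2 (Finset.mem_singleton_self v))
    have hcl : IsClosedIn G Finset.univ (N m).1 :=
      ⟨Finset.subset_univ _, fun u hu x _ h => hemp ((hN.isSeparation m hm).2 u hu x h)⟩
    have := hcl.eq_univ hG hv1
    exact Finset.notMem_erase w Finset.univ (h2.1 (this ▸ Finset.mem_univ w))
  have hreg : region (N 0) (N T) = Finset.univ := by
    rw [h0, hT]
    simp [region]
  have main := (hN.solvable T 0 T (Nat.zero_le _) le_rfl (by omega) (fun m h1 h2 => by
      rw [h0, hT, sepL, sepR]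
      exact ⟨hpos m h2.le, hpos m h2.le⟩) Finset.univ (by rw [hreg]; exact hC) k
    (fun m _ hm => by rw [Finset.univ_inter]; exact hN.card_le m hm)).1
  rw [h0, hT, sepL, sepR] at main
  exact ⟨v, _, main {v} (Finset.subset_univ _) subset_rfl (Finset.singleton_nonempty v)⟩

/-- A chain of connected sets that exhausts the graph gives a connected path decomposition whose
bags are the boundaries of the sets together with the new vertices. -/
theorem exists_pathDecomposition_of_chain [Fintype V] {n b : ℕ} (U : ℕ → Finset V)
    (h0 : U 0 = ∅) (hn : U n = Finset.univ) (hU : ∀ i < n, U i ⊆ U (i + 1))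
    (hconn : ∀ i < n, (G.induce (U (i + 1) : Set V)).Connected)
    (hb : ∀ i < n, (active G Finset.univ ∅ (U i) ∪ (U (i + 1) \ U i)).card ≤ b) :
    ∃ P : PathDecomposition G, P.IsConnected ∧ ∀ i, (P.bag i).card ≤ b := by
  have mono : ∀ i j, i ≤ j → j ≤ n → U i ⊆ U j := by
    intro i j hij
    induction j, hij using Nat.le_induction with
    | base => exact fun _ => subset_rfl
    | succ j _ ih => exact fun hj => (ih (by omega)).trans (hU j (by omega))
  have enter : ∀ v, ∃ i < n, v ∉ U i ∧ v ∈ U (i + 1) := by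
    intro v
    have hex : ∃ m, v ∈ U m := ⟨n, hn ▸ Finset.mem_univ v⟩
    classical
    have hm := Nat.find_spec hex
    have hmin := @Nat.find_min _ _ hex
    have hle : Nat.find hex ≤ n := Nat.find_min' hex (hn ▸ Finset.mem_univ v)
    have hpos : Nat.find hex ≠ 0 := fun h => by
      rw [h, h0] at hm
      exact Finset.notMem_empty v hm
    refine ⟨Nat.find hex - 1, by omega, hmin (by omega), ?_⟩
    rwa [Nat.sub_add_cancel (by omega)]
  have bag_sub : ∀ i < n, active G Finset.univ ∅ (U i) ∪ (U (i + 1) \ U i) ⊆ U (i + 1) := by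
    intro i hi x hx
    rcases Finset.mem_union.1 hx with h | h
    · exact hU i hi (mem_active.1 h).1
    · exact (Finset.mem_sdiff.1 h).1
  have edge : ∀ u v i, v ∉ U i → u ∈ U i → G.Adj u v → u ∈ active G Finset.univ ∅ (U i) :=
    fun u v i hv hu h => mem_active.2 ⟨hu, Or.inr ⟨v, Finset.mem_univ v, hv, h⟩⟩
  refine ⟨{ d := n
            bag := fun i => active G Finset.univ ∅ (U i) ∪ (U (i + 1) \ U i)
            exists_mem_bag := ?_
            exists_edge_bag := ?_
            mem_bag_of_le_of_le := ?_ }, ?_, fun i => hb i i.2⟩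
  · intro v
    obtain ⟨i, hi, h1, h2⟩ := enter v
    exact ⟨⟨i, hi⟩, Finset.mem_union_right _ (Finset.mem_sdiff.2 ⟨h2, h1⟩)⟩
  · intro u v huv
    obtain ⟨i, hi, h1, h2⟩ := enter u
    obtain ⟨j, hj, h3, h4⟩ := enter v
    -- the edge lies in the bag in which the later of its two ends is new
    rcases lt_trichotomy i j with hij | rfl | hij
    · exact ⟨⟨j, hj⟩, Finset.mem_union_left _
        (edge u v j h3 (mono (i + 1) j hij hj.le h2) huv),
        Finset.mem_union_right _ (Finset.mem_sdiff.2 ⟨h4, h3⟩)⟩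
    · exact ⟨⟨i, hi⟩, Finset.mem_union_right _ (Finset.mem_sdiff.2 ⟨h2, h1⟩),
        Finset.mem_union_right _ (Finset.mem_sdiff.2 ⟨h4, h3⟩)⟩
    · exact ⟨⟨i, hi⟩, Finset.mem_union_right _ (Finset.mem_sdiff.2 ⟨h2, h1⟩),
        Finset.mem_union_left _ (edge v u i h1 (mono (j + 1) i hij hi.le h4) huv.symm)⟩
  · intro i j k hij hjk v hvi hvk
    rcases hij.eq_or_lt with rfl | hij'
    · exact hvi
    · have hvj : v ∈ U j := mono (i + 1) j hij' j.2.le (bag_sub i i.2 hvi)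
      have hvk' : v ∈ U k := mono j k hjk k.2.le hvj
      rcases Finset.mem_union.1 hvk with h | h
      · obtain ⟨_, h | ⟨y, _, hy, hvy⟩⟩ := mem_active.1 h
        · exact absurd h (Finset.notMem_empty v)
        · exact Finset.mem_union_left _
            (edge v y j (fun hyj => hy (mono j k hjk k.2.le hyj)) hvj hvy)
      · exact absurd hvk' (Finset.mem_sdiff.1 h).2
  · intro i
    have hset : (⋃ j ≤ i, ((active G Finset.univ ∅ (U j) ∪ (U (j + 1) \ U j) : Finset V) :
        Set V)) = (U (i + 1) : Set V) := by
      ext v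
      simp only [Set.mem_iUnion, Finset.mem_coe]
      constructor
      · rintro ⟨j, hj, hv⟩
        exact mono (j + 1) (i + 1) (by have := Fin.le_def.1 hj; omega) i.2 (bag_sub j j.2 hv)
      · intro hv
        obtain ⟨j, hj, h1, h2⟩ := enter v
        refine ⟨⟨j, hj⟩, ?_, Finset.mem_union_right _ (Finset.mem_sdiff.2 ⟨h2, h1⟩)⟩
        by_contra hlt
        exact h1 (mono (i + 1) j (Fin.lt_def.1 (not_le.1 hlt)) hj.le hv)
    change (G.induce (⋃ j ≤ i, ((active G Finset.univ ∅ (U j) ∪ (U (j + 1) \ U j) : Finset V) :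
        Set V))).Connected
    rw [hset]
    exact hconn i i.2

theorem exists_seq_of_reflTransGen {α : Type*} {r : α → α → Prop} {a b : α}
    (h : Relation.ReflTransGen r a b) :
    ∃ (n : ℕ) (u : ℕ → α), u 0 = a ∧ u n = b ∧ ∀ i < n, r (u i) (u (i + 1)) := by
  induction h using Relation.ReflTransGen.head_induction_on with
  | refl => exact ⟨0, fun _ => b, rfl, rfl, fun i hi => absurd hi (Nat.not_lt_zero i)⟩
  | @head a c h _ ih =>
    obtain ⟨n, u, h0, hn, hu⟩ := ih
    refine ⟨n + 1, fun m => Nat.casesOn m a u, rfl, hn, fun i hi => ?_⟩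
    cases i with
    | zero => change r a (u 0); rw [h0]; exact h
    | succ i => exact hu i (by omega)

theorem connected_induce_insert {U : Finset V} {x y : V} (hU : (G.induce (U : Set V)).Connected)
    (hy : y ∈ U) (h : G.Adj y x) : (G.induce ((insert x U : Finset V) : Set V)).Connected := by
  have h1 := SimpleGraph.induce_union_connected hU.preconnected
    (SimpleGraph.induce_pair_connected_of_adj h).preconnected ⟨y, hy, by simp⟩
  have h2 : (U : Set V) ∪ {y, x} = ((insert x U : Finset V) : Set V) := by
    ext z
    have : z = y → z ∈ U := fun e => e ▸ hy
    simp only [Set.mem_union, Finset.mem_coe, Set.mem_insert_iff, Set.mem_singleton_iff,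
      Finset.mem_insert]
    tauto
  rwa [h2] at h1

/-- A vertex-by-vertex exploration of the whole graph gives a connected path decomposition whose
bags consist of the active vertices and one new vertex. -/
theorem exists_pathDecomposition_of_grow [Fintype V] {v : V} {Z : Finset V} {b : ℕ}
    (hb : 1 ≤ b) (h : Grow G Finset.univ Z b {v} Finset.univ) :
    ∃ P : PathDecomposition G, P.IsConnected ∧ ∀ i, (P.bag i).card ≤ b + 1 := by
  obtain ⟨n, u, h0, hn, hu⟩ := exists_seq_of_reflTransGen h
  let U : ℕ → Finset V := fun m => Nat.casesOn m ∅ u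
  have conn : ∀ i ≤ n, (G.induce (u i : Set V)).Connected := by
    intro i
    induction i with
    | zero =>
      intro _
      rw [h0, Finset.coe_singleton]
      have : Subsingleton ({v} : Set V) := inferInstance
      exact ⟨fun a b => by rw [Subsingleton.elim a b]⟩
    | succ i ih =>
      intro hi
      obtain ⟨x, _, _, ⟨y, hy, hyx⟩, he, _⟩ := hu i hi
      rw [he]
      exact connected_induce_insert (ih (by omega)) hy hyx
  have act : ∀ i ≤ n, (active G Finset.univ ∅ (u i)).card ≤ b := by
    intro i hi
    cases i with
    | zero =>
      refine le_trans (Finset.card_le_card (t := {v}) ?_) ((Finset.card_singleton v).le.trans hb)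
      rw [← h0]
      exact fun x hx => (mem_active.1 hx).1
    | succ i =>
      obtain ⟨_, _, _, _, _, hc⟩ := hu i hi
      refine le_trans (Finset.card_le_card fun x hx => ?_) hc
      rw [mem_active] at hx ⊢
      exact ⟨hx.1, Or.inr (hx.2.resolve_left (Finset.notMem_empty x))⟩
  refine exists_pathDecomposition_of_chain (n := n + 1) U rfl hn ?_ ?_ ?_
  · intro i hi
    cases i with
    | zero => exact Finset.empty_subset _
    | succ i =>
      obtain ⟨x, _, _, _, he, _⟩ := hu i (by omega)
      change u i ⊆ u (i + 1)
      rw [he]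
      exact Finset.subset_insert _ _
  · intro i hi
    exact conn i (by omega)
  · intro i hi
    refine (Finset.card_union_le _ _).trans ?_
    cases i with
    | zero =>
      have h1 : active G Finset.univ ∅ (U 0) = ∅ :=
        Finset.subset_empty.1 fun x hx => (mem_active.1 hx).1
      have h2 : (U (0 + 1) \ U 0).card ≤ 1 := by
        change (u 0 \ ∅).card ≤ 1
        rw [h0, Finset.sdiff_empty, Finset.card_singleton]
      rw [h1, Finset.card_empty]
      omega
    | succ i =>
      have h1 : (active G Finset.univ ∅ (U (i + 1))).card ≤ b := act i (by omega)
      have h2 : (U (i + 1 + 1) \ U (i + 1)).card ≤ 1 := by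
        change (u (i + 1) \ u i).card ≤ 1
        obtain ⟨x, _, hx, _, he, _⟩ := hu i (by omega)
        rw [he, Finset.insert_sdiff_of_notMem _ hx, Finset.sdiff_self, insert_empty_eq,
          Finset.card_singleton]
      omega

end ConnectedPathwidth

theorem mainTheorem1 {V : Type*} [Finite V] (G : SimpleGraph V) (hG : G.Connected) :
    connectedPathwidth G ≤ 2 * pathwidth G + 1 := by
  classical
  have := Fintype.ofFinite V
  have := hG.nonempty
  obtain ⟨P, hP⟩ := (pathwidth_isLeast G).1
  have hk : ∀ i, (P.bag i).card ≤ pathwidth G + 1 := by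
    intro i
    rw [← hP, P.width_add_one]
    exact Finset.le_sup (f := fun i => (P.bag i).card) (Finset.mem_univ i)
  obtain ⟨v, Z, h⟩ := ConnectedPathwidth.exists_grow hG P hk
  obtain ⟨Q, hQ, hc⟩ := ConnectedPathwidth.exists_pathDecomposition_of_grow (by omega) h
  refine ((connectedPathwidth_isLeast G hG).2 ⟨Q, hQ, rfl⟩).trans ?_
  have h1 := Q.width_add_one
  have h2 : (Finset.univ.sup fun i => (Q.bag i).card) ≤ 2 * (pathwidth G + 1) - 1 + 1 :=
    Finset.sup_le fun i _ => hc i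
  omega
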